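/- Model. Two players, Alice and Bob, divide the cake $[0,1]$. Fix a constant $D>1$. A valuation $v$ is given by an integrable density $v:[0,1]\to\mathbb R_{\ge 0}$ with $\int_0^1 v=1$ and $v([a,b]):=\int_a^b v\le D(b-a)$ for all $0\le a<b\le 1$; it is the private input of the player, and $v(S)=\int_S v$. An allocation $(A_1,A_2)$ splits $[0,1]$ into two pieces, each a finite union of intervals, that overlap in at most finitely many points. It has at most $C$ cuts if there is a set of at most $C$ points such that any two points of $[0,1]$ not separated by (and not themselves) one of them lie in the same pieces; it is connected if both pieces are intervals. It is $\epsilon$-perfect if $|v_i(A_j)-1/2|\le\epsilon$ for all $i,j\in\{1,2\}$, and $\epsilon$-equitable if $|v_1(A_1)-v_2(A_2)|\le\epsilon$. A deterministic $[t,r]$-protocol has $r$ rounds; in each round each player sends at most $t$ bits, depending on her or his own input and the messages of the earlier rounds, and the output allocation is determined by the final transcript. A randomized $[t,r]$-protocol may in addition use public coins (seen by both players, and on which the output may depend) and independent private coins. Theorem. For all constants $D>1$, $K\in\mathbb R$, $k\in\mathbb N$ and every constant error $\delta<1$ there are $c>0$ and $\epsilon_0>0$ such that for all $0<\epsilon<\epsilon_0$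 and all $t\le K(\log\epsilon^{-1})^k$ the following holds. Every deterministic $[t,r]$-protocol, and every randomized $[t,r]$-protocol with error probability at most $\delta$ on every pair of valuations, that finds either (a) an $\epsilon$-perfect allocation with at most 2 cuts between two players, or (b) a connected $\epsilon$-equitable allocation between two players, has $$ r\ \ge\ c\,\frac{\log \epsilon^{-1}}{\log\log\epsilon^{-1}} $$ rounds. That is, $\Omega(\log\epsilon^{-1}/\log\log\epsilon^{-1})$ rounds of $\mathrm{polylog}(\epsilon^{-1})$ bits are needed for either problem. -/

import Mathlib

open Filter Topology MeasureTheory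

universe u

namespace CakeCutting

/-! ### The cake `[0,1]`, valuations and allocations -/

/-- A normalized valuation of the cake `[0,1]`, given by a nonnegative integrable density
(only its restriction to `[0,1]` matters), whose density is bounded by `D` in the sense that every
interval `[a,b]` is worth at most `D * (b - a)`. -/
structure Valuation (D : ℝ) where
  density : ℝ → ℝ
  nonneg : ∀ x ∈ Set.Icc (0 : ℝ) 1, 0 ≤ density x
  integrable : IntegrableOn density (Set.Icc 0 1)
  total : ∫ x in Set.Icc (0 : ℝ) 1, density x = 1
  bounded : ∀ a b : ℝ, 0 ≤ a → a < b → b ≤ 1 → ∫ x in Set.Icc a b, density x ≤ D * (b - a)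

/-- The value of a set `S ⊆ [0,1]`. -/
noncomputable def Valuation.value {D : ℝ} (v : Valuation D) (S : Set ℝ) : ℝ :=
  ∫ x in S, v.density x

/-- A piece of cake: a finite union of disjoint intervals (open, closed, half-open or degenerate)
contained in `[0,1]`. -/
def IsPiece (S : Set ℝ) : Prop :=
  S ⊆ Set.Icc 0 1 ∧
    ∃ F : Set (Set ℝ), F.Finite ∧ (∀ I ∈ F, I.OrdConnected) ∧ F.PairwiseDisjoint id ∧ S = ⋃₀ F

/-- An allocation of the cake among `n` players. As usual, intervals that share only
endpoints count as disjoint, so different pieces may overlap in finitely many points. -/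
structure Allocation (n : ℕ) where
  piece : Fin n → Set ℝ
  isPiece : ∀ i, IsPiece (piece i)
  disjoint : ∀ i j, i ≠ j → (piece i ∩ piece j).Finite
  cover : ⋃ i, piece i = Set.Icc 0 1

/-- The cuts at the points of `S` demarcate the allocation: two points of the cake that are not
separated by a cut belong to the same pieces. -/
def Allocation.Demarcates {n : ℕ} (A : Allocation n) (S : Finset ℝ) : Prop :=
  ∀ x ∈ Set.Icc (0 : ℝ) 1, ∀ y ∈ Set.Icc (0 : ℝ) 1, x < y → (∀ s ∈ S, s ∉ Set.Icc x y) →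
    ∀ i, x ∈ A.piece i ↔ y ∈ A.piece i

/-- At most `C` cuts are needed to demarcate the allocation. -/
def Allocation.CutsLE {n : ℕ} (A : Allocation n) (C : ℕ) : Prop :=
  ∃ S : Finset ℝ, S.card ≤ C ∧ A.Demarcates S

/-- Every player receives a single interval. -/
def Allocation.Connected {n : ℕ} (A : Allocation n) : Prop :=
  ∀ i, (A.piece i).OrdConnected

/-- `ε`-perfection: all players value all pieces at `1/n`, up to `ε`. -/
def IsPerfect {n : ℕ} {D : ℝ} (ε : ℝ) (v : Fin n → Valuation D) (A : Allocation n) : Prop :=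
  ∀ i j, |(v i).value (A.piece j) - 1 / (n : ℝ)| ≤ ε

/-- `ε`-equitability: all players value their own pieces equally, up to `ε`. -/
def IsEquitable {n : ℕ} {D : ℝ} (ε : ℝ) (v : Fin n → Valuation D) (A : Allocation n) : Prop :=
  ∀ i j, |(v i).value (A.piece i) - (v j).value (A.piece j)| ≤ ε

/-- The search problem: find an `ε`-perfect allocation with (at most) 2 cuts between 2 players. -/
def PerfectTwoCuts (D ε : ℝ) (vA vB : Valuation D) (A : Allocation 2) : Prop :=
  A.CutsLE 2 ∧ IsPerfect ε ![vA, vB] A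

/-- The search problem: find a connected `ε`-equitable allocation between 2 players. -/
def ConnectedEquitable (D ε : ℝ) (vA vB : Valuation D) (A : Allocation 2) : Prop :=
  A.Connected ∧ IsEquitable ε ![vA, vB] A

/-! ### Two-player communication protocols with rounds -/

/-- The messages (bit strings) sent by Alice and by Bob in the rounds so far, oldest first. -/
abbrev Transcript := List (List Bool × List Bool)

/-- A deterministic protocol for inputs in `X` (Alice) and `Y` (Bob) and outputs in `Z`. In each
round both players simultaneously send a bit string, possibly empty, that depends on their own
input and on the messages of the earlier rounds; protocols in which only one player
speaks in each round are included. The output is a function of the final transcript (the leaf). -/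
structure Protocol (X Y Z : Type*) where
  rounds : ℕ
  alice : X → Transcript → List Bool
  bob : Y → Transcript → List Bool
  output : Transcript → Z

namespace Protocol

variable {X Y Z : Type*}

/-- The transcript after the given number of rounds on the inputs `x`, `y`. -/
def transcript (P : Protocol X Y Z) (x : X) (y : Y) : ℕ → Transcript
  | 0 => []
  | k + 1 => P.transcript x y k ++
      [(P.alice x (P.transcript x y k), P.bob y (P.transcript x y k))]

/-- The output of the protocol on the inputs `x`, `y`. -/
def run (P : Protocol X Y Z) (x : X) (y : Y) : Z :=
  P.output (P.transcript x y P.rounds)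

/-- A `[t,r]`-protocol: it has `r` rounds, and in each of them every player sends at most `t`
bits, on all inputs. -/
def IsTR (P : Protocol X Y Z) (t r : ℕ) : Prop :=
  P.rounds = r ∧ ∀ x y, ∀ k < r,
    (P.alice x (P.transcript x y k)).length ≤ t ∧ (P.bob y (P.transcript x y k)).length ≤ t

end Protocol

/-- Some deterministic `[t,r]`-protocol solves the search problem `R` on all inputs. -/
def DeterministicallySolvable {X Y Z : Type*} (R : X → Y → Z → Prop) (t r : ℕ) : Prop :=
  ∃ P : Protocol X Y Z, P.IsTR t r ∧ ∀ x y, R x y (P.run x y)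

/-- Some randomized `[t,r]`-protocol solves the search problem `R` with probability of error at most
`δ` on every input. The public coins `Ω` select a deterministic protocol in which Alice knows also
her private coins `ΩA` and Bob his private coins `ΩB`; the three are independent. Trivial
coin spaces give the purely public-coin and the purely private-coin model. -/
def RandomizedSolvable {X Y Z : Type*} (R : X → Y → Z → Prop) (δ : ℝ) (t r : ℕ) : Prop :=
  ∃ (Ω ΩA ΩB : Type u) (_ : MeasurableSpace Ω) (_ : MeasurableSpace ΩA) (_ : MeasurableSpace ΩB)
    (μ : Measure Ω) (μA : Measure ΩA) (μB : Measure ΩB)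
    (_ : IsProbabilityMeasure μ) (_ : IsProbabilityMeasure μA) (_ : IsProbabilityMeasure μB)
    (P : Ω → Protocol (X × ΩA) (Y × ΩB) Z),
    (∀ ω, (P ω).IsTR t r) ∧
    ∀ x y, ∃ E : Set (Ω × ΩA × ΩB), MeasurableSet E ∧
      ENNReal.ofReal (1 - δ) ≤ (μ.prod (μA.prod μB)) E ∧
      ∀ e ∈ E, R x y ((P e.1).run (x, e.2.1) (y, e.2.2))

end CakeCutting

namespace CakeCutting

/-! Both problems hide a crossing problem: Alice holds a nondecreasing `F` and Bob a nondecreasing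
`G`, each rising from 0 to 1, and a point where `F + G` is nearly 1 is sought. In a connected
equitable allocation the cut is such a point (`encodesCrossing_connectedEquitable`). For perfect
allocations the uniform valuation is perturbed along `F` and `G` with opposite signs, so that
comparing the two players' conditions cancels the lengths and leaves a crossing
(`encodesCrossing_perfectTwoCuts`).

The crossing problem contains a tree search. One function stacks `B` smaller profiles in consecutive
blocks; the other is constant on all blocks but one, at a height that forces the crossing into block
`i`, where a rescaled crossing problem with swapped roles remains. At depth `n`, a point with error
below `width B ^ n` reveals the whole path (`exists_decoder`).

The tree search is hard because the holder of the `B` subproblems speaks first without knowing which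
one matters, so a short message hardly helps with a random one. `round_elimination` proves this
without information theory: for a fixed message the irrelevant coordinates are replaced by the best
possible ones, which turns the total success into a sum of independent terms; a Chernoff bound and a
union bound over messages finish. Each removed message costs `2 * l + |M| * exp (-(l ^ 2 * B))`, and
with no message left the first index is guessed with probability at most `1 / B` (`sum_success_le`).

These bounds are averages over uniform inputs, so the coins of a randomized protocol can be fixed.
Its `r` rounds become `2 * r` alternating messages, to be beaten at depth `2 * r + 1`. With `B`
polylogarithmic in `1/ε`, the precision `width B ^ (2 * r + 1)` stays above `ε`, up to a constant,
while `r` is a small multiple of `log ε⁻¹ / log log ε⁻¹`, yet the success bound tends to 0. -/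

/-! ### Alternating protocols and round elimination -/

/-- `f` is computed by `k` alternating messages with values in `M`; the holder of the first
argument speaks first. -/
def AltComputable (M : Type) {Z : Type} : ℕ → {U V : Type} → (U → V → Z) → Prop
  | 0, _, _, f => ∃ z, ∀ u v, f u v = z
  | k + 1, U, V, f => ∃ (m : U → M) (g : M → V → U → Z),
      (∀ a, AltComputable M k (g a)) ∧ ∀ u v, f u v = g (m u) v u

theorem AltComputable.comp {M Z Z' : Type} (φ : Z → Z') :
    ∀ {k : ℕ} {U V U' V' : Type} {f : U → V → Z}, AltComputable M k f →
      ∀ (a : U' → U) (b : V' → V), AltComputable M k fun u v => φ (f (a u) (b v))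
  | 0, _, _, _, _, _, h, _, _ => by
    obtain ⟨z, hz⟩ := h
    exact ⟨φ z, fun u v => congrArg φ (hz _ _)⟩
  | k + 1, _, _, _, _, _, h, a, b => by
    obtain ⟨m, g, hg, hf⟩ := h
    exact ⟨fun u => m (a u), fun c v u => φ (g c (b v) (a u)), fun c => (hg c).comp φ b a,
      fun u v => congrArg φ (hf _ _)⟩

/-- The Chernoff moment bound, with counting in place of probability: the sum over all `x` factors
over the coordinates, and `exp y ≤ 1 + y + y ^ 2` together with `g ^ 2 ≤ g` bounds each factor. -/
theorem sum_exp_sum_le {Z : Type} [Fintype Z] {B : ℕ} (g : Fin B → Z → ℝ) {s l : ℝ}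
    (hl0 : 0 ≤ l) (hl1 : l ≤ 1) (hg0 : ∀ i z, 0 ≤ g i z) (hg1 : ∀ i z, g i z ≤ 1)
    (hs : ∀ i, ∑ z, g i z ≤ s * Fintype.card Z) :
    ∑ x : Fin B → Z, Real.exp (l * ∑ i, g i (x i)) ≤
      Fintype.card Z ^ B * Real.exp ((l + l ^ 2) * s * B) := by
  have h1 : ∀ i z, Real.exp (l * g i z) ≤ 1 + (l + l ^ 2) * g i z := by
    intro i z
    have h2 : |l * g i z| ≤ 1 := by
      rw [abs_of_nonneg (mul_nonneg hl0 (hg0 i z))]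
      exact mul_le_one₀ hl1 (hg0 i z) (hg1 i z)
    have h3 := (abs_le.1 (Real.abs_exp_sub_one_sub_id_le h2)).2
    have h4 : g i z ^ 2 ≤ g i z := by
      rw [sq]; exact mul_le_of_le_one_left (hg0 i z) (hg1 i z)
    have h5 := mul_le_mul_of_nonneg_left h4 (sq_nonneg l)
    linarith [mul_pow l (g i z) 2]
  have h6 : ∀ i, ∑ z, Real.exp (l * g i z) ≤ Fintype.card Z * Real.exp ((l + l ^ 2) * s) := by
    intro i
    calc ∑ z, Real.exp (l * g i z) ≤ ∑ z, (1 + (l + l ^ 2) * g i z) :=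
          Finset.sum_le_sum fun z _ => h1 i z
      _ = Fintype.card Z + (l + l ^ 2) * ∑ z, g i z := by
          rw [Finset.sum_add_distrib, Finset.mul_sum]; simp
      _ ≤ Fintype.card Z + (l + l ^ 2) * (s * Fintype.card Z) := by gcongr; exact hs i
      _ = Fintype.card Z * ((l + l ^ 2) * s + 1) := by ring
      _ ≤ _ := by gcongr; exact Real.add_one_le_exp _
  calc ∑ x : Fin B → Z, Real.exp (l * ∑ i, g i (x i))
      = ∑ x : Fin B → Z, ∏ i, Real.exp (l * g i (x i)) := by
        simp_rw [Finset.mul_sum, Real.exp_sum]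
    _ = ∏ i, ∑ z, Real.exp (l * g i z) := by
        rw [Finset.prod_univ_sum, Fintype.piFinset_univ]
    _ ≤ ∏ _i : Fin B, (Fintype.card Z * Real.exp ((l + l ^ 2) * s)) :=
        Finset.prod_le_prod (fun i _ => Finset.sum_nonneg fun z _ => (Real.exp_pos _).le)
          fun i _ => h6 i
    _ = _ := by
        rw [Finset.prod_const, Finset.card_univ, Fintype.card_fin, mul_pow, ← Real.exp_nat_mul]
        ring_nf

/-- Here `W a i x` stands for the success after message `a` when subproblem `i` is selected.
Hypothesis `hs` says that, with `a` and `i` fixed, no way of filling in the other coordinates from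
`z` alone succeeds on average better than `s`; the message then gains only the error term. -/
theorem round_elimination {M Z : Type} [Fintype M] [Fintype Z] {B : ℕ}
    (W : M → Fin B → (Fin B → Z) → ℝ) {s l : ℝ} (hl0 : 0 ≤ l) (hl1 : l ≤ 1)
    (hW0 : ∀ a i x, 0 ≤ W a i x) (hW1 : ∀ a i x, W a i x ≤ 1)
    (hs : ∀ a i (sel : Z → Fin B → Z), (∀ z, sel z i = z) →
      ∑ z, W a i (sel z) ≤ s * Fintype.card Z)
    (m : (Fin B → Z) → M) :
    ∑ x, ∑ i, W (m x) i x ≤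
      (s + (2 * l + Fintype.card M * Real.exp (-(l ^ 2 * B)))) * (B * Fintype.card Z ^ B) := by
  classical
  have hcard : ((Fintype.card (Fin B → Z) : ℕ) : ℝ) = Fintype.card Z ^ B := by simp
  by_cases hs1 : 1 < s
  · calc ∑ x, ∑ i, W (m x) i x ≤ ∑ _x : Fin B → Z, ∑ _i : Fin B, (1 : ℝ) :=
          Finset.sum_le_sum fun x _ => Finset.sum_le_sum fun i _ => hW1 _ _ _
      _ = 1 * (B * Fintype.card Z ^ B) := by
          rw [Finset.sum_const, Finset.card_univ, nsmul_eq_mul, hcard]; simp; ring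
      _ ≤ _ := by
          gcongr
          have : 0 ≤ Fintype.card M * Real.exp (-(l ^ 2 * B)) := by positivity
          linarith
  push Not at hs1
  -- The best completion of `z` depends only on `a`, `i` and `z`; hence the terms of `G a` below are
  -- functions of separate coordinates, that is, independent.
  have hsel : ∀ a i z, ∃ x : Fin B → Z, x i = z ∧ ∀ x', x' i = z → W a i x' ≤ W a i x := by
    intro a i z
    obtain ⟨x, hx, hmax⟩ := Finset.exists_max_image
      (Finset.univ.filter fun x : Fin B → Z => x i = z) (W a i) ⟨fun _ => z, by simp⟩
    refine ⟨x, by simpa using hx, fun x' hx' => hmax x' (by simpa using hx')⟩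
  choose sel hsel1 hsel2 using hsel
  set G : M → (Fin B → Z) → ℝ := fun a x => ∑ i, W a i (sel a i (x i)) with hG
  -- When `G` exceeds its threshold, the exponential is at least 1 and pays for the trivial bound
  -- `B`. Summing over all `a` is the union bound over messages.
  have hbound : ∀ x, ∑ i, W (m x) i x ≤
      (s + 2 * l) * B + B * ∑ a, Real.exp (l * (G a x - (s + 2 * l) * B)) := by
    intro x
    have h1 : ∑ i, W (m x) i x ≤ G (m x) x :=
      Finset.sum_le_sum fun i _ => hsel2 _ _ _ _ rfl
    have h2 : ∑ i, W (m x) i x ≤ B :=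
      (Finset.sum_le_sum fun i _ => hW1 (m x) i x).trans (by simp)
    have h3 : Real.exp (l * (G (m x) x - (s + 2 * l) * B)) ≤
        ∑ a, Real.exp (l * (G a x - (s + 2 * l) * B)) :=
      Finset.single_le_sum (f := fun a => Real.exp (l * (G a x - (s + 2 * l) * B)))
        (fun a _ => (Real.exp_pos _).le) (Finset.mem_univ _)
    have h0 : 0 ≤ ∑ a, Real.exp (l * (G a x - (s + 2 * l) * B)) :=
      Finset.sum_nonneg fun a _ => (Real.exp_pos _).le
    have hB : (0 : ℝ) ≤ B := Nat.cast_nonneg B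
    rcases le_total (G (m x) x) ((s + 2 * l) * B) with h | h
    · have := mul_nonneg hB h0
      linarith
    · have h4 : 1 ≤ Real.exp (l * (G (m x) x - (s + 2 * l) * B)) :=
        Real.one_le_exp (mul_nonneg hl0 (sub_nonneg.2 h))
      have h5 := mul_le_mul_of_nonneg_left (h4.trans h3) hB
      rcases isEmpty_or_nonempty (Fin B) with hB' | ⟨⟨i⟩⟩
      · simp [hG] at h ⊢
        have : B = 0 := by
          by_contra hne
          exact hB'.elim ⟨0, Nat.pos_of_ne_zero hne⟩
        simp [this]
      · have hs0 : 0 ≤ s * Fintype.card Z :=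
          (Finset.sum_nonneg fun z _ => hW0 (m x) i _).trans
            (hs (m x) i (fun z => sel (m x) i z) fun z => hsel1 _ _ _)
        have hZ : (0 : ℝ) < Fintype.card Z := Nat.cast_pos.2 (Fintype.card_pos_iff.2 ⟨x i⟩)
        have hs0 : 0 ≤ s := nonneg_of_mul_nonneg_left hs0 hZ
        have : 0 ≤ (s + 2 * l) * B := by positivity
        linarith
  have hexp : ∀ a, ∑ x, Real.exp (l * (G a x - (s + 2 * l) * B)) ≤
      Fintype.card Z ^ B * Real.exp (-(l ^ 2 * B)) := by
    intro a
    have h1 := sum_exp_sum_le (fun i z => W a i (sel a i z)) hl0 hl1 (fun i z => hW0 _ _ _)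
      (fun i z => hW1 _ _ _) (fun i => hs a i _ fun z => hsel1 a i z)
    calc ∑ x, Real.exp (l * (G a x - (s + 2 * l) * B))
        = (∑ x : Fin B → Z, Real.exp (l * ∑ i, W a i (sel a i (x i)))) *
            Real.exp (-(l * ((s + 2 * l) * B))) := by
          rw [Finset.sum_mul]
          refine Finset.sum_congr rfl fun x _ => ?_
          rw [← Real.exp_add]; congr 1; simp only [hG]; ring
      _ ≤ (Fintype.card Z ^ B * Real.exp ((l + l ^ 2) * s * B)) *
            Real.exp (-(l * ((s + 2 * l) * B))) := by gcongr
      -- The threshold `s + 2 * l` leaves the exponent `l ^ 2 * B * (s - 2)`, which is at most `-(l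
      -- ^ 2 * B)` because `s ≤ 1`.
      _ = Fintype.card Z ^ B * Real.exp (l ^ 2 * B * (s - 1) - l ^ 2 * B) := by
          rw [mul_assoc, ← Real.exp_add]; ring_nf
      _ ≤ _ := by
          gcongr
          have : l ^ 2 * B * (s - 1) ≤ 0 :=
            mul_nonpos_of_nonneg_of_nonpos (by positivity) (by linarith)
          linarith
  calc ∑ x, ∑ i, W (m x) i x
      ≤ ∑ x, ((s + 2 * l) * B + B * ∑ a, Real.exp (l * (G a x - (s + 2 * l) * B))) :=
        Finset.sum_le_sum fun x _ => hbound x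
    _ = Fintype.card Z ^ B * ((s + 2 * l) * B) +
          B * ∑ a, ∑ x, Real.exp (l * (G a x - (s + 2 * l) * B)) := by
        rw [Finset.sum_add_distrib, Finset.sum_const, Finset.card_univ, nsmul_eq_mul, hcard,
          ← Finset.mul_sum, Finset.sum_comm]
    _ ≤ Fintype.card Z ^ B * ((s + 2 * l) * B) +
          B * ∑ _a : M, (Fintype.card Z ^ B * Real.exp (-(l ^ 2 * B))) := by
        gcongr with a _; exact hexp a
    _ = _ := by
        rw [Finset.sum_const, Finset.card_univ, nsmul_eq_mul]; ring

/-! ### The tree search problem -/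

/-- The two input spaces of the tree search problem of depth `n`: the first player has `B`
subproblems, the second player selects one of them and takes the other part in it. -/
def Inst (B : ℕ) : ℕ → Type × Type
  | 0 => (Unit, Unit)
  | n + 1 => (Fin B → (Inst B n).2, Fin B × (Inst B n).1)

theorem finite_inst (B : ℕ) : ∀ n, Finite (Inst B n).1 ∧ Finite (Inst B n).2
  | 0 => ⟨inferInstanceAs (Finite Unit), inferInstanceAs (Finite Unit)⟩
  | n + 1 => by
    obtain ⟨h1, h2⟩ := finite_inst B n
    exact ⟨inferInstanceAs (Finite (Fin B → (Inst B n).2)),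
      inferInstanceAs (Finite (Fin B × (Inst B n).1))⟩

noncomputable instance (B n : ℕ) : Fintype (Inst B n).1 :=
  @Fintype.ofFinite _ (finite_inst B n).1

noncomputable instance (B n : ℕ) : Fintype (Inst B n).2 :=
  @Fintype.ofFinite _ (finite_inst B n).2

theorem nonempty_inst {B : ℕ} (hB : 0 < B) :
    ∀ n, Nonempty (Inst B n).1 ∧ Nonempty (Inst B n).2
  | 0 => ⟨⟨()⟩, ⟨()⟩⟩
  | n + 1 => by
    obtain ⟨⟨p⟩, ⟨q⟩⟩ := nonempty_inst hB n
    exact ⟨⟨fun _ => q⟩, ⟨(⟨0, hB⟩, p)⟩⟩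

/-- The path of the tree search problem. -/
def path {B : ℕ} : (n : ℕ) → (Inst B n).1 → (Inst B n).2 → List (Fin B)
  | 0, _, _ => []
  | n + 1, x, y => y.1 :: path n y.2 (x y.1)

theorem card_inst_succ_fst (B n : ℕ) :
    Fintype.card (Inst B (n + 1)).1 = Fintype.card (Inst B n).2 ^ B := by
  have : Fintype.card (Inst B (n + 1)).1 = Fintype.card (Fin B → (Inst B n).2) :=
    Fintype.card_congr (Equiv.refl _)
  rw [this]; simp

theorem card_inst_succ_snd (B n : ℕ) :
    Fintype.card (Inst B (n + 1)).2 = B * Fintype.card (Inst B n).1 := by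
  have : Fintype.card (Inst B (n + 1)).2 = Fintype.card (Fin B × (Inst B n).1) :=
    Fintype.card_congr (Equiv.refl _)
  rw [this]; simp

theorem sum_inst_succ (B n : ℕ) (F : (Fin B → (Inst B n).2) → Fin B → (Inst B n).1 → ℝ) :
    ∑ x : (Inst B (n + 1)).1, ∑ y : (Inst B (n + 1)).2, F x y.1 y.2 =
      ∑ x : Fin B → (Inst B n).2, ∑ i, ∑ y, F x i y := by
  have h1 : ∀ x : Fin B → (Inst B n).2, ∑ y : (Inst B (n + 1)).2, F x y.1 y.2 =
      ∑ i, ∑ y, F x i y := by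
    intro x
    rw [← Fintype.sum_prod_type' (F x)]
    exact Fintype.sum_equiv (show (Inst B (n + 1)).2 ≃ Fin B × (Inst B n).1 from Equiv.refl _)
      _ _ fun _ => rfl
  rw [← Finset.sum_congr rfl fun x _ => h1 x]
  exact Fintype.sum_equiv
    (show (Inst B (n + 1)).1 ≃ (Fin B → (Inst B n).2) from Equiv.refl _) _ _ fun _ => rfl

-- Induction on the number of messages, one fewer than the depth: `round_elimination` removes the
-- first message together with the top level, after which the other player speaks first in the
-- selected subproblem.
open Classical in
theorem sum_success_le {M : Type} [Fintype M] {B : ℕ} (hB : 0 < B) {l : ℝ} (hl0 : 0 ≤ l)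
    (hl1 : l ≤ 1) : ∀ (k : ℕ) (f : (Inst B (k + 1)).1 → (Inst B (k + 1)).2 → List (Fin B)),
      AltComputable M k f →
      ∑ x, ∑ y, (if f x y = path (k + 1) x y then (1 : ℝ) else 0) ≤
        (1 / B + k * (2 * l + Fintype.card M * Real.exp (-(l ^ 2 * B)))) *
          (Fintype.card (Inst B (k + 1)).2 * Fintype.card (Inst B (k + 1)).1)
  | 0, f, hf => by
    have hB' : (0 : ℝ) < B := Nat.cast_pos.2 hB
    obtain ⟨z, hz⟩ := hf
    have h1 : ∀ x : Fin B → (Inst B 0).2, ∑ i, ∑ y : (Inst B 0).1,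
        (if z = i :: path 0 y (x i) then (1 : ℝ) else 0) ≤ Fintype.card (Inst B 0).1 := by
      intro x
      -- A constant answer has one head, so it fits at most one of the `B` indices.
      rw [Finset.sum_comm]
      calc _ ≤ ∑ y : (Inst B 0).1, (1 : ℝ) := by
            refine Finset.sum_le_sum fun y _ => ?_
            rw [Finset.sum_boole]
            norm_cast
            refine Finset.card_le_one.2 fun i hi j hj => ?_
            simp only [Finset.mem_filter, Finset.mem_univ, true_and] at hi hj
            have := hi.symm.trans hj
            simpa using (List.cons.inj this).1
        _ = _ := by simp
    have h2 := sum_inst_succ B 0 fun x i y => if z = i :: path 0 y (x i) then (1 : ℝ) else 0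
    simp only [hz]
    calc _ = _ := h2
      _ ≤ ∑ x : Fin B → (Inst B 0).2, (Fintype.card (Inst B 0).1 : ℝ) :=
          Finset.sum_le_sum fun x _ => h1 x
      _ = _ := by
          rw [card_inst_succ_fst, card_inst_succ_snd]
          simp
          field_simp
  | k + 1, f, hf => by
    have hB' : (0 : ℝ) < B := Nat.cast_pos.2 hB
    obtain ⟨m, g, hg, hfg⟩ := hf
    have hP : (0 : ℝ) < Fintype.card (Inst B (k + 1)).1 :=
      Nat.cast_pos.2 (Fintype.card_pos_iff.2 (nonempty_inst hB _).1)
    set W : M → Fin B → (Fin B → (Inst B (k + 1)).2) → ℝ := fun a i x =>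
      (∑ y, if g a (i, y) x = i :: path (k + 1) y (x i) then (1 : ℝ) else 0) /
        Fintype.card (Inst B (k + 1)).1 with hW
    have key := round_elimination W
      (s := 1 / B + k * (2 * l + Fintype.card M * Real.exp (-(l ^ 2 * B)))) hl0 hl1
      (fun a i x => by
        simp only [hW]
        exact div_nonneg (Finset.sum_nonneg fun y _ => by split_ifs <;> norm_num) hP.le)
      (fun a i x => by
        simp only [hW]
        rw [div_le_one hP]
        calc _ ≤ ∑ y : (Inst B (k + 1)).1, (1 : ℝ) :=
              Finset.sum_le_sum fun y _ => by split_ifs <;> norm_num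
          _ = _ := by simp)
      (fun a i sel hsel => by
        -- With `a` and `i` fixed, the holder of `z` plays as if holding `sel z`, so the remaining
        -- protocol solves the subproblem; dropping the head `i` leaves its path.
        have ih := sum_success_le hB hl0 hl1 k (fun y z => (g a (i, y) (sel z)).tail)
          ((hg a).comp List.tail (fun y => (i, y)) sel)
        simp only [hW]
        rw [← Finset.sum_div, div_le_iff₀ hP, Finset.sum_comm, mul_assoc]
        refine le_trans (Finset.sum_le_sum fun y _ => Finset.sum_le_sum fun z _ => ?_) ih
        rw [hsel]
        split_ifs with h1 h2 h2
        · exact le_rfl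
        · exact absurd (by rw [h1]; rfl) h2
        · norm_num
        · exact le_rfl) m
    have h2 := sum_inst_succ B (k + 1) fun x i y =>
      if g (m x) (i, y) x = i :: path (k + 1) y (x i) then (1 : ℝ) else 0
    have h3 : ∑ x : Fin B → (Inst B (k + 1)).2, ∑ i, ∑ y,
        (if g (m x) (i, y) x = i :: path (k + 1) y (x i) then (1 : ℝ) else 0) =
        (∑ x : Fin B → (Inst B (k + 1)).2, ∑ i, W (m x) i x) *
          Fintype.card (Inst B (k + 1)).1 := by
      simp only [hW, Finset.sum_mul]
      refine Finset.sum_congr rfl fun x _ => Finset.sum_congr rfl fun i _ => ?_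
      rw [div_mul_cancel₀ _ hP.ne']
    simp only [hfg]
    calc _ = _ := h2.trans h3
      _ ≤ (1 / B + k * (2 * l + Fintype.card M * Real.exp (-(l ^ 2 * B))) +
            (2 * l + Fintype.card M * Real.exp (-(l ^ 2 * B)))) *
            (B * Fintype.card (Inst B (k + 1)).2 ^ B) * Fintype.card (Inst B (k + 1)).1 :=
        mul_le_mul_of_nonneg_right key hP.le
      _ = _ := by
          rw [card_inst_succ_fst B (k + 1), card_inst_succ_snd B (k + 1)]
          push_cast
          ring

/-! ### Encoding the tree search problem by monotone functions -/

/-- The projection to `[0,1]`. -/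
noncomputable def clamp (p : ℝ) : ℝ := max 0 (min p 1)

theorem clamp_of_nonpos {p : ℝ} (h : p ≤ 0) : clamp p = 0 := by
  unfold clamp; grind

theorem clamp_of_one_le {p : ℝ} (h : 1 ≤ p) : clamp p = 1 := by
  unfold clamp; grind

theorem clamp_nonneg (p : ℝ) : 0 ≤ clamp p := le_max_left _ _

theorem clamp_le_one (p : ℝ) : clamp p ≤ 1 := by
  unfold clamp; grind

theorem clamp_mono {a b : ℝ} (h : a ≤ b) : clamp a ≤ clamp b := by
  unfold clamp; grind

theorem clamp_sub_le {a b : ℝ} (h : a ≤ b) : clamp b - clamp a ≤ b - a := by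
  unfold clamp; grind

/-- Nondecreasing functions from `0` to `1` whose slope is at most `3` on `[0,1]` and vanishes
outside. -/
structure IsProfile (F : ℝ → ℝ) : Prop where
  zero : F 0 = 0
  one : F 1 = 1
  mono : ∀ {a b}, a ≤ b → F a ≤ F b
  lip : ∀ {a b}, a ≤ b → F b - F a ≤ 3 * (clamp b - clamp a)

namespace IsProfile

variable {F : ℝ → ℝ}

theorem of_nonpos (hF : IsProfile F) {p : ℝ} (hp : p ≤ 0) : F p = 0 := by
  have h1 := hF.mono hp
  have h2 := hF.lip hp
  rw [clamp_of_nonpos hp, clamp_of_nonpos le_rfl] at h2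
  linarith [hF.zero]

theorem of_one_le (hF : IsProfile F) {p : ℝ} (hp : 1 ≤ p) : F p = 1 := by
  have h1 := hF.mono hp
  have h2 := hF.lip hp
  rw [clamp_of_one_le hp, clamp_of_one_le le_rfl] at h2
  linarith [hF.one]

theorem nonneg (hF : IsProfile F) (p : ℝ) : 0 ≤ F p := by
  rcases le_total p 0 with h | h
  · exact (hF.of_nonpos h).ge
  · exact hF.zero.ge.trans (hF.mono h)

theorem le_one (hF : IsProfile F) (p : ℝ) : F p ≤ 1 := by
  rcases le_total p 1 with h | h
  · exact (hF.mono h).trans hF.one.le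
  · exact (hF.of_one_le h).le

end IsProfile

theorem isProfile_clamp : IsProfile clamp where
  zero := clamp_of_nonpos le_rfl
  one := clamp_of_one_le le_rfl
  mono := clamp_mono
  lip h := by linarith [clamp_mono h]

/-- The width of each of `B` blocks that partition `[1/4,3/4]`. -/
noncomputable def width (B : ℕ) : ℝ := 1 / (2 * B)

/-- The left end of block `j`. -/
noncomputable def start (B j : ℕ) : ℝ := 1 / 4 + j * width B

theorem width_pos {B : ℕ} (hB : 0 < B) : 0 < width B := by
  unfold width
  have : (0 : ℝ) < B := Nat.cast_pos.2 hB
  positivity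

theorem mul_width {B : ℕ} (hB : 0 < B) : B * width B = 1 / 2 := by
  unfold width
  have : (0 : ℝ) < B := Nat.cast_pos.2 hB
  field_simp

theorem start_succ (B j : ℕ) : start B (j + 1) = start B j + width B := by
  unfold start; push_cast; ring

theorem quarter_le_start (B j : ℕ) : 1 / 4 ≤ start B j := by
  unfold start width
  have : 0 ≤ (j : ℝ) * (1 / (2 * B)) := by positivity
  linarith

theorem start_mono {B i j : ℕ} (h : i ≤ j) : start B i ≤ start B j := by
  unfold start width
  gcongr

theorem start_self {B : ℕ} (hB : 0 < B) : start B B = 3 / 4 := by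
  unfold start; rw [mul_width hB]; norm_num

theorem start_add_width_le {B : ℕ} (i : Fin B) : start B i + width B ≤ 3 / 4 := by
  rw [← start_succ, ← start_self i.pos]
  exact start_mono i.isLt

theorem width_mul_clamp {w s p : ℝ} (hw : 0 < w) (hs : 1 / 4 ≤ s) :
    w * clamp ((p - s) / w) = min (max p (1 / 4)) (s + w) - min (max p (1 / 4)) s := by
  unfold clamp
  rw [mul_max_of_nonneg _ _ hw.le, mul_min_of_nonneg _ _ hw.le, mul_div_cancel₀ _ hw.ne']
  grind

/-- Splits the growth of `clamp` over the two outer quarters and the blocks, so that the slope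
bounds of profiles can be checked piece by piece and added. -/
theorem clamp_eq_sum {B : ℕ} (hB : 0 < B) (p : ℝ) :
    clamp p = clamp (4 * p) / 4 + ∑ j : Fin B, width B * clamp ((p - start B j) / width B) +
      clamp (4 * p - 3) / 4 := by
  have h1 : ∑ j : Fin B, width B * clamp ((p - start B j) / width B) =
      min (max p (1 / 4)) (3 / 4) - min (max p (1 / 4)) (1 / 4) := by
    calc _ = ∑ j : Fin B, (min (max p (1 / 4)) (start B (j + 1)) -
          min (max p (1 / 4)) (start B j)) := by
          refine Finset.sum_congr rfl fun j _ => ?_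
          rw [width_mul_clamp (width_pos hB) (quarter_le_start B j), start_succ]
      _ = ∑ j ∈ Finset.range B, (min (max p (1 / 4)) (start B (j + 1)) -
          min (max p (1 / 4)) (start B j)) :=
          Fin.sum_univ_eq_sum_range (fun j => min (max p (1 / 4)) (start B (j + 1)) -
            min (max p (1 / 4)) (start B j)) B
      _ = _ := by
          rw [Finset.sum_range_sub fun j => min (max p (1 / 4)) (start B j), start_self hB]
          simp [start]
  rw [h1]
  unfold clamp
  rcases le_total p (1 / 4) with h | h
  · rw [max_eq_right h]
    grind
  rw [max_eq_left h, min_eq_right h, min_eq_right (a := 4 * p) (by linarith)]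
  rcases le_total p (3 / 4) with h' | h'
  · rw [min_eq_left h']
    grind
  · rw [min_eq_right h']
    grind

/-- The function that climbs along `F j` in block `j`. -/
noncomputable def multiProfile {B : ℕ} (F : Fin B → ℝ → ℝ) (p : ℝ) : ℝ :=
  clamp (4 * p) / 4 + ∑ j, width B * F j ((p - start B j) / width B) + clamp (4 * p - 3) / 4

/-- The function that climbs along `F` in block `i` and is constant on the other blocks. -/
noncomputable def singleProfile (B i : ℕ) (F : ℝ → ℝ) (p : ℝ) : ℝ :=
  (1 - start B i - width B) * clamp (4 * p) + width B * F ((p - start B i) / width B) +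
    start B i * clamp (4 * p - 3)

theorem multiProfile_eq {B : ℕ} {F : Fin B → ℝ → ℝ} (hF : ∀ j, IsProfile (F j)) (i : Fin B)
    {p : ℝ} (h1 : start B i ≤ p) (h2 : p ≤ start B i + width B) :
    multiProfile F p = start B i + width B * F i ((p - start B i) / width B) := by
  have hw := width_pos i.pos
  have h3 := quarter_le_start B i
  have h4 := start_add_width_le i
  -- Blocks to the left of `i` have been climbed completely, those to the right not at all.
  have h5 : ∀ j : Fin B, width B * F j ((p - start B j) / width B) =
      (if j < i then width B else 0) +
        if j = i then width B * F i ((p - start B i) / width B) else 0 := by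
    intro j
    rcases lt_trichotomy j i with h | h | h
    · have h6 : start B (j + 1) ≤ start B i := start_mono h
      rw [start_succ] at h6
      rw [(hF j).of_one_le (by rw [le_div_iff₀ hw]; linarith)]
      simp [h, h.ne]
    · simp [h]
    · have h6 : start B (i + 1) ≤ start B j := start_mono h
      rw [start_succ] at h6
      rw [(hF j).of_nonpos (div_nonpos_of_nonpos_of_nonneg (by linarith) hw.le)]
      simp [h.not_gt, h.ne']
  unfold multiProfile
  rw [clamp_of_one_le (by linarith), clamp_of_nonpos (by linarith),
    Finset.sum_congr rfl fun j _ => h5 j, Finset.sum_add_distrib, Finset.sum_ite_eq' Finset.univ i,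
    ← Finset.sum_filter, Finset.sum_const, nsmul_eq_mul]
  have h6 : (Finset.univ.filter fun j => j < i) = Finset.Iio i := by ext; simp
  rw [h6, Fin.card_Iio]
  simp [start, add_assoc]

theorem singleProfile_eq {B : ℕ} {F : ℝ → ℝ} (i : Fin B) {p : ℝ} (h1 : start B i ≤ p)
    (h2 : p ≤ start B i + width B) :
    singleProfile B i F p =
      1 - start B i - width B + width B * F ((p - start B i) / width B) := by
  have h3 := quarter_le_start B i
  have h4 := start_add_width_le i
  unfold singleProfile
  rw [clamp_of_one_le (by linarith), clamp_of_nonpos (by linarith)]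
  ring

theorem isProfile_multiProfile {B : ℕ} (hB : 0 < B) {F : Fin B → ℝ → ℝ}
    (hF : ∀ j, IsProfile (F j)) : IsProfile (multiProfile F) := by
  have hw := width_pos hB
  have hmono : ∀ {a b : ℝ}, a ≤ b → ∀ s, (a - s) / width B ≤ (b - s) / width B := by
    intro a b h s; gcongr
  have hlip : ∀ {a b : ℝ}, a ≤ b →
      multiProfile F b - multiProfile F a ≤ 3 * (clamp b - clamp a) := by
    intro a b h
    have h1 := clamp_mono (show 4 * a ≤ 4 * b by linarith)
    have h2 := clamp_mono (show 4 * a - 3 ≤ 4 * b - 3 by linarith)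
    have h3 : ∑ j, width B * F j ((b - start B j) / width B) -
        ∑ j, width B * F j ((a - start B j) / width B) ≤
        3 * (∑ j : Fin B, width B * clamp ((b - start B j) / width B) -
        ∑ j : Fin B, width B * clamp ((a - start B j) / width B)) := by
      rw [← Finset.sum_sub_distrib, ← Finset.sum_sub_distrib, Finset.mul_sum]
      refine Finset.sum_le_sum fun j _ => ?_
      have := mul_le_mul_of_nonneg_left ((hF j).lip (hmono h (start B j))) hw.le
      linarith
    rw [clamp_eq_sum hB a, clamp_eq_sum hB b]
    unfold multiProfile
    linarith
  refine ⟨?_, ?_, ?_, hlip⟩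
  · unfold multiProfile
    rw [clamp_of_nonpos (by norm_num), clamp_of_nonpos (by norm_num), Finset.sum_eq_zero]
    · norm_num
    · intro j _
      rw [(hF j).of_nonpos, mul_zero]
      exact div_nonpos_of_nonpos_of_nonneg (by linarith [quarter_le_start B j]) hw.le
  · unfold multiProfile
    rw [clamp_of_one_le (by norm_num), clamp_of_one_le (by norm_num),
      Finset.sum_congr rfl fun j _ => ?_, Finset.sum_const, Finset.card_univ, Fintype.card_fin,
      nsmul_eq_mul, mul_width hB]
    · norm_num
    · rw [(hF j).of_one_le, mul_one]
      rw [le_div_iff₀ hw]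
      linarith [start_add_width_le j]
  · intro a b h
    have h1 := clamp_mono (show 4 * a ≤ 4 * b by linarith)
    have h2 := clamp_mono (show 4 * a - 3 ≤ 4 * b - 3 by linarith)
    have h3 : ∑ j, width B * F j ((a - start B j) / width B) ≤
        ∑ j, width B * F j ((b - start B j) / width B) :=
      Finset.sum_le_sum fun j _ => mul_le_mul_of_nonneg_left ((hF j).mono (hmono h _)) hw.le
    unfold multiProfile
    linarith

/-- The constant 3 in `IsProfile` comes from here: the outer ramps have slopes `4 * (1 - start B i -
width B)` and `4 * start B i`, both at most 3 since the blocks lie in `[1/4,3/4]`. In the block,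
both axes are scaled by `width B`, which preserves slopes. -/
theorem isProfile_singleProfile {B : ℕ} (i : Fin B) {F : ℝ → ℝ} (hF : IsProfile F) :
    IsProfile (singleProfile B i F) := by
  have hw := width_pos i.pos
  have hs1 := quarter_le_start B i
  have hs2 := start_add_width_le i
  have hmono : ∀ {a b : ℝ}, a ≤ b → ∀ s, (a - s) / width B ≤ (b - s) / width B := by
    intro a b h s; gcongr
  refine ⟨?_, ?_, ?_, ?_⟩
  · unfold singleProfile
    rw [clamp_of_nonpos (by norm_num), clamp_of_nonpos (by norm_num), hF.of_nonpos]
    · ring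
    · exact div_nonpos_of_nonpos_of_nonneg (by linarith) hw.le
  · unfold singleProfile
    rw [clamp_of_one_le (by norm_num), clamp_of_one_le (by norm_num), hF.of_one_le]
    · ring
    · rw [le_div_iff₀ hw]
      linarith
  · intro a b h
    unfold singleProfile
    gcongr
    · linarith
    · exact clamp_mono (by linarith)
    · exact hF.mono (hmono h _)
    · exact clamp_mono (by linarith)
  · intro a b h
    have h1 := clamp_mono (show 4 * a ≤ 4 * b by linarith)
    have h2 := clamp_mono (show 4 * a - 3 ≤ 4 * b - 3 by linarith)
    have h3 : width B * clamp ((b - start B i) / width B) -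
        width B * clamp ((a - start B i) / width B) ≤
        ∑ j : Fin B, width B * clamp ((b - start B j) / width B) -
        ∑ j : Fin B, width B * clamp ((a - start B j) / width B) := by
      rw [← Finset.sum_sub_distrib]
      refine Finset.single_le_sum (f := fun j : Fin B =>
        width B * clamp ((b - start B j) / width B) -
        width B * clamp ((a - start B j) / width B)) (fun j _ => ?_) (Finset.mem_univ i)
      exact sub_nonneg.2 (mul_le_mul_of_nonneg_left (clamp_mono (hmono h _)) hw.le)
    have h4 := mul_le_mul_of_nonneg_left (hF.lip (hmono h (start B i))) hw.le
    have h5 : (1 - start B i - width B) * (clamp (4 * b) - clamp (4 * a)) ≤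
        3 / 4 * (clamp (4 * b) - clamp (4 * a)) :=
      mul_le_mul_of_nonneg_right (by linarith) (by linarith)
    have h6 : start B i * (clamp (4 * b - 3) - clamp (4 * a - 3)) ≤
        3 / 4 * (clamp (4 * b - 3) - clamp (4 * a - 3)) :=
      mul_le_mul_of_nonneg_right (by linarith) (by linarith)
    rw [clamp_eq_sum i.pos a, clamp_eq_sum i.pos b]
    unfold singleProfile
    linarith

/-- A near-crossing of the two functions lies in the selected block, and is a near-crossing of
the functions that are embedded there. -/
theorem mem_block_of_abs_lt {B : ℕ} {F : Fin B → ℝ → ℝ} {G : ℝ → ℝ}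
    (hF : ∀ j, IsProfile (F j)) (hG : IsProfile G) (i : Fin B) {p e : ℝ} (he : e ≤ 1)
    (h : |multiProfile F p + singleProfile B i G p - 1| < width B * e) :
    (start B i < p ∧ p < start B i + width B) ∧
      |G ((p - start B i) / width B) + F i ((p - start B i) / width B) - 1| < e := by
  have hw := width_pos i.pos
  have hPF := isProfile_multiProfile i.pos hF
  have hPG := isProfile_singleProfile i hG
  have hwe : width B * e ≤ width B := mul_le_of_le_one_right hw.le he
  obtain ⟨h1, h2⟩ := abs_lt.1 h
  -- At the left end of block `i` the two functions add up to `1 - width B`, at the right end to `1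
  -- + width B`; monotonicity excludes everything outside.
  have hleft : start B i < p := by
    by_contra! hp
    have h3 := hPF.mono hp
    have h4 := hPG.mono hp
    rw [multiProfile_eq hF i le_rfl (by linarith), sub_self, zero_div, (hF i).zero] at h3
    rw [singleProfile_eq i le_rfl (by linarith), sub_self, zero_div, hG.zero] at h4
    linarith
  have hright : p < start B i + width B := by
    by_contra! hp
    have h3 := hPF.mono hp
    have h4 := hPG.mono hp
    have h5 : (start B i + width B - start B i) / width B = 1 := by
      rw [add_sub_cancel_left, div_self hw.ne']
    rw [multiProfile_eq hF i (by linarith) le_rfl, h5, (hF i).one] at h3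
    rw [singleProfile_eq i (by linarith) le_rfl, h5, hG.one] at h4
    linarith
  refine ⟨⟨hleft, hright⟩, ?_⟩
  rw [multiProfile_eq hF i hleft.le hright.le, singleProfile_eq i hleft.le hright.le] at h
  have h3 : start B i + width B * F i ((p - start B i) / width B) +
      (1 - start B i - width B + width B * G ((p - start B i) / width B)) - 1 =
      width B * (G ((p - start B i) / width B) + F i ((p - start B i) / width B) - 1) := by
    ring
  rw [h3, abs_mul, abs_of_pos hw] at h
  exact lt_of_mul_lt_mul_left h hw.le

theorem block_unique {B : ℕ} {i j : Fin B} {p : ℝ} (hi1 : start B i < p)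
    (hi2 : p < start B i + width B) (hj1 : start B j < p) (hj2 : p < start B j + width B) :
    i = j := by
  rw [← start_succ] at hi2 hj2
  rcases lt_trichotomy i j with h | h | h
  · have : start B (i + 1) ≤ start B j := start_mono h
    linarith
  · exact h
  · have : start B (j + 1) ≤ start B i := start_mono h
    linarith

/-- The functions that encode the inputs of the tree search problem. -/
noncomputable def profile (B : ℕ) :
    (n : ℕ) → ((Inst B n).1 → ℝ → ℝ) × ((Inst B n).2 → ℝ → ℝ)
  | 0 => (fun _ => clamp, fun _ => clamp)
  | n + 1 => (fun x => multiProfile fun j => (profile B n).2 (x j),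
      fun y => singleProfile B y.1 ((profile B n).1 y.2))

theorem isProfile_profile {B : ℕ} (hB : 0 < B) : ∀ n,
    (∀ x, IsProfile ((profile B n).1 x)) ∧ ∀ y, IsProfile ((profile B n).2 y)
  | 0 => ⟨fun _ => isProfile_clamp, fun _ => isProfile_clamp⟩
  | n + 1 => by
    obtain ⟨h1, h2⟩ := isProfile_profile hB n
    exact ⟨fun x => isProfile_multiProfile hB fun j => h2 _,
      fun y => isProfile_singleProfile y.1 (h1 _)⟩

/-- The block containing `p` gives the first index; zooming into it multiplies the error by `1 /
width B` and swaps the two players, which the symmetric crossing condition permits. -/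
theorem exists_decoder {B : ℕ} (hB : 0 < B) : ∀ n, ∃ dec : ℝ → List (Fin B), ∀ x y p,
    |(profile B n).1 x p + (profile B n).2 y p - 1| < width B ^ n → dec p = path n x y
  | 0 => ⟨fun _ => [], fun _ _ _ _ => rfl⟩
  | n + 1 => by
    classical
    obtain ⟨dec, hdec⟩ := exists_decoder hB n
    refine ⟨fun p => if h : ∃ j : Fin B, start B j < p ∧ p < start B j + width B then
      h.choose :: dec ((p - start B h.choose) / width B) else [], fun x y p hp => ?_⟩
    have hw := width_pos hB
    have hw1 : width B ≤ 1 := by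
      have h1 := start_add_width_le ⟨0, hB⟩
      have h2 := quarter_le_start B (⟨0, hB⟩ : Fin B)
      linarith
    rw [pow_succ'] at hp
    obtain ⟨hblock, habs⟩ := mem_block_of_abs_lt (fun j => (isProfile_profile hB n).2 (x j))
      ((isProfile_profile hB n).1 y.2) y.1 (pow_le_one₀ hw.le hw1) hp
    have hex : ∃ j : Fin B, start B j < p ∧ p < start B j + width B := ⟨y.1, hblock⟩
    have heq : hex.choose = y.1 :=
      block_unique hex.choose_spec.1 hex.choose_spec.2 hblock.1 hblock.2
    simp only [dif_pos hex, heq]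
    rw [hdec y.2 (x y.1) _ habs]
    rfl

/-! ### Valuations and allocations in terms of cumulative values -/

namespace Valuation

variable {D : ℝ}

/-- The value of the cake to the left of `p`. -/
noncomputable def cdf (v : Valuation D) (p : ℝ) : ℝ := ∫ x in (0 : ℝ)..p, v.density x

theorem intervalIntegrable (v : Valuation D) {a b : ℝ} (ha : 0 ≤ a) (hab : a ≤ b) (hb : b ≤ 1) :
    IntervalIntegrable v.density volume a b :=
  (intervalIntegrable_iff_integrableOn_Icc_of_le hab).2
    (v.integrable.mono_set (Set.Icc_subset_Icc ha hb))

@[simp] theorem cdf_zero (v : Valuation D) : v.cdf 0 = 0 := by simp [cdf]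

@[simp] theorem cdf_one (v : Valuation D) : v.cdf 1 = 1 := by
  rw [cdf, intervalIntegral.integral_of_le zero_le_one, ← integral_Icc_eq_integral_Ioc, v.total]

theorem value_Ioo (v : Valuation D) {a b : ℝ} (ha : 0 ≤ a) (hab : a ≤ b) (hb : b ≤ 1) :
    v.value (Set.Ioo a b) = v.cdf b - v.cdf a := by
  have h1 := intervalIntegral.integral_add_adjacent_intervals
    (v.intervalIntegrable le_rfl ha (hab.trans hb)) (v.intervalIntegrable ha hab hb)
  rw [value, ← integral_Ioc_eq_integral_Ioo, ← intervalIntegral.integral_of_le hab, cdf, cdf]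
  linarith

theorem value_congr (v : Valuation D) {S T E : Set ℝ} (hE : E.Finite)
    (h : ∀ x, x ∉ E → (x ∈ S ↔ x ∈ T)) : v.value S = v.value T := by
  refine setIntegral_congr_set ?_
  filter_upwards [compl_mem_ae_iff.2 (hE.measure_zero volume)] with x hx
  exact propext (h x hx)

theorem value_union (v : Valuation D) {S T : Set ℝ} (hST : Disjoint S T) (hT : MeasurableSet T)
    (hS1 : S ⊆ Set.Icc 0 1) (hT1 : T ⊆ Set.Icc 0 1) :
    v.value (S ∪ T) = v.value S + v.value T :=
  setIntegral_union hST hT (v.integrable.mono_set hS1) (v.integrable.mono_set hT1)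

end Valuation

/-- Every function with slopes between `0` and `D` is a cumulative value. -/
theorem exists_valuation {D : ℝ} (U : ℝ → ℝ) (h0 : U 0 = 0) (h1 : U 1 = 1)
    (hmono : ∀ {a b}, a ≤ b → U a ≤ U b) (hlip : ∀ {a b}, a ≤ b → U b - U a ≤ D * (b - a)) :
    ∃ v : Valuation D, ∀ p, v.cdf p = U p := by
  -- A Lipschitz function is absolutely continuous, hence the integral of its derivative; that
  -- derivative serves as the density.
  have hac : ∀ a b, AbsolutelyContinuousOnInterval U a b := by
    have hD : 0 ≤ D := by linarith [hlip (zero_le_one (α := ℝ))]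
    have hl : LipschitzWith (Real.toNNReal D) U := by
      refine LipschitzWith.of_le_add_mul _ fun x y => ?_
      rw [Real.coe_toNNReal D hD]
      rcases le_total x y with h | h
      · exact (hmono h).trans (le_add_of_nonneg_right (mul_nonneg hD dist_nonneg))
      · rw [Real.dist_eq, abs_of_nonneg (sub_nonneg.2 h)]
        linarith [hlip h]
    exact fun a b => hl.lipschitzOnWith.absolutelyContinuousOnInterval
  refine ⟨{
    density := deriv U
    nonneg := fun x _ => Monotone.deriv_nonneg (fun _ _ h => hmono h)
    integrable := (intervalIntegrable_iff_integrableOn_Icc_of_le zero_le_one).1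
      (hac 0 1).intervalIntegrable_deriv
    total := by
      rw [integral_Icc_eq_integral_Ioc, ← intervalIntegral.integral_of_le zero_le_one,
        (hac 0 1).integral_deriv_eq_sub, h0, h1, sub_zero]
    bounded := fun a b _ hab _ => by
      rw [integral_Icc_eq_integral_Ioc, ← intervalIntegral.integral_of_le hab.le,
        (hac a b).integral_deriv_eq_sub]
      exact hlip hab.le }, fun p => ?_⟩
  rw [Valuation.cdf, (hac 0 p).integral_deriv_eq_sub, h0, sub_zero]

theorem Allocation.exists_cut {A : Allocation 2} {i j : Fin 2} (hij : i ≠ j)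
    (h0 : 0 ∈ A.piece i) (hi : (A.piece i).OrdConnected) :
    ∃ p : ℝ, 0 ≤ p ∧ p ≤ 1 ∧ ∀ {D : ℝ} (v : Valuation D),
      v.value (A.piece i) = v.cdf p ∧ v.value (A.piece j) = 1 - v.cdf p := by
  have hsub : A.piece i ⊆ Set.Icc 0 1 := (A.isPiece i).1
  have hbdd : BddAbove (A.piece i) := ⟨1, fun x hx => (hsub hx).2⟩
  set p := sSup (A.piece i) with hp
  have hp0 : 0 ≤ p := le_csSup hbdd h0
  have hp1 : p ≤ 1 := csSup_le ⟨0, h0⟩ fun x hx => (hsub hx).2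
  have hmem : ∀ x, 0 ≤ x → x < p → x ∈ A.piece i := by
    intro x hx0 hxp
    obtain ⟨y, hy, hxy⟩ := exists_lt_of_lt_csSup ⟨0, h0⟩ hxp
    exact hi.out h0 hy ⟨hx0, hxy.le⟩
  have hnmem : ∀ x, p < x → x ∉ A.piece i := fun x hx hxi => hx.not_ge (le_csSup hbdd hxi)
  have hcov : ∀ x, 0 ≤ x → x ≤ 1 → x ∈ A.piece i ∨ x ∈ A.piece j := by
    intro x hx0 hx1
    have : x ∈ ⋃ l, A.piece l := by rw [A.cover]; exact ⟨hx0, hx1⟩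
    obtain ⟨l, hl⟩ := Set.mem_iUnion.1 this
    have : l = i ∨ l = j := by omega
    rcases this with rfl | rfl
    · exact Or.inl hl
    · exact Or.inr hl
  refine ⟨p, hp0, hp1, fun v => ⟨?_, ?_⟩⟩
  · rw [v.value_congr (T := Set.Ioo 0 p) (E := {0, p}) (by simp), v.value_Ioo le_rfl hp0 hp1,
      v.cdf_zero, sub_zero]
    intro x hx
    simp only [Set.mem_insert_iff, Set.mem_singleton_iff, not_or] at hx
    constructor
    · exact fun h => ⟨(hsub h).1.lt_of_ne' hx.1, (le_csSup hbdd h).lt_of_ne hx.2⟩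
    · exact fun h => hmem x h.1.le h.2
  · rw [v.value_congr (T := Set.Ioo p 1) (E := (A.piece i ∩ A.piece j) ∪ {p, 1})
      ((A.disjoint i j hij).union (by simp)), v.value_Ioo hp0 hp1 le_rfl, v.cdf_one]
    intro x hx
    simp only [Set.mem_union, Set.mem_inter_iff, Set.mem_insert_iff, Set.mem_singleton_iff,
      not_or, not_and] at hx
    constructor
    · intro h
      have hx01 := (A.isPiece j).1 h
      refine ⟨lt_of_not_ge fun hxp => ?_, hx01.2.lt_of_ne hx.2.2⟩
      exact hx.1 (hmem x hx01.1 (hxp.lt_of_ne hx.2.1)) h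
    · intro h
      exact (hcov x (hp0.trans h.1.le) h.2.le).resolve_left (hnmem x h.1)

/-- Whichever player gets the left piece, comparing `v.cdf p` with `1 - w.cdf p` or `w.cdf p` with
`1 - v.cdf p` is the same condition. -/
theorem Allocation.Connected.exists_cut {A : Allocation 2} (hA : A.Connected) :
    ∃ p : ℝ, ∀ {D e : ℝ} (v w : Valuation D), IsEquitable e ![v, w] A →
      |v.cdf p + w.cdf p - 1| ≤ e := by
  have h0 : (0 : ℝ) ∈ ⋃ l, A.piece l := by rw [A.cover]; exact ⟨le_rfl, zero_le_one⟩
  obtain ⟨l, hl⟩ := Set.mem_iUnion.1 h0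
  fin_cases l
  · obtain ⟨p, -, -, hp⟩ := Allocation.exists_cut (j := 1) (by decide) hl (hA _)
    refine ⟨p, fun v w h => ?_⟩
    have := h 0 1
    simp only [Matrix.cons_val_zero, Matrix.cons_val_one] at this
    rw [(hp w).2, show v.value (A.piece 0) = _ from (hp v).1] at this
    convert this using 2
    ring
  · obtain ⟨p, -, -, hp⟩ := Allocation.exists_cut (j := 0) (by decide) hl (hA _)
    refine ⟨p, fun v w h => ?_⟩
    have := h 1 0
    simp only [Matrix.cons_val_zero, Matrix.cons_val_one] at this
    rw [(hp v).2, show w.value (A.piece 1) = _ from (hp w).1] at this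
    convert this using 2
    ring

theorem exists_subset_pair {S : Finset ℝ} (hS : S.card ≤ 2) :
    ∃ a b, a ≤ b ∧ S ⊆ {a, b} := by
  obtain ⟨T, hST, hT⟩ := Infinite.exists_superset_card_eq S 2 hS
  obtain ⟨a, b, -, rfl⟩ := Finset.card_eq_two.1 hT
  rcases le_total a b with h | h
  · exact ⟨a, b, h, hST⟩
  · exact ⟨b, a, h, by rwa [Finset.pair_comm]⟩

theorem Allocation.Demarcates.inter_Ioo {n : ℕ} {A : Allocation n} {S : Finset ℝ}
    (hA : A.Demarcates S) {a b : ℝ} (ha : 0 ≤ a) (hb : b ≤ 1)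
    (hS : ∀ s ∈ S, s ∉ Set.Ioo a b) (i : Fin n) :
    A.piece i ∩ Set.Ioo a b = ∅ ∨ A.piece i ∩ Set.Ioo a b = Set.Ioo a b := by
  rcases Set.eq_empty_or_nonempty (A.piece i ∩ Set.Ioo a b) with h | ⟨x, hxi, hx⟩
  · exact Or.inl h
  refine Or.inr (Set.inter_eq_right.2 fun y hy => ?_)
  have hmem : ∀ z, z ∈ Set.Ioo a b → z ∈ Set.Icc (0 : ℝ) 1 :=
    fun z hz => ⟨ha.trans hz.1.le, hz.2.le.trans hb⟩
  have hsep : ∀ {z w : ℝ}, z ∈ Set.Ioo a b → w ∈ Set.Ioo a b → ∀ s ∈ S, s ∉ Set.Icc z w :=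
    fun hz hw s hs h => hS s hs ⟨hz.1.trans_le h.1, h.2.trans_lt hw.2⟩
  rcases lt_trichotomy x y with h | h | h
  · exact (hA x (hmem x hx) y (hmem y hy) h (hsep hx hy) i).1 hxi
  · exact h ▸ hxi
  · exact (hA y (hmem y hy) x (hmem x hx) h (hsep hy hx) i).2 hxi

/-- Two cuts leave three intervals, and up to finitely many points piece 0 is a union of some of
them. Either this union or its complement is an interval, and both are equally far from one half. -/
theorem Allocation.CutsLE.exists_interval {A : Allocation 2} (hA : A.CutsLE 2) :
    ∃ p q : ℝ, 0 ≤ p ∧ p ≤ q ∧ q ≤ 1 ∧ ∀ {D : ℝ} (v : Valuation D),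
      |v.cdf q - v.cdf p - 1 / 2| = |v.value (A.piece 0) - 1 / 2| := by
  obtain ⟨S, hcard, hS⟩ := hA
  obtain ⟨a, b, hab, hsub⟩ := exists_subset_pair hcard
  obtain ⟨p, hp⟩ : ∃ p, p = clamp a := ⟨_, rfl⟩
  obtain ⟨q, hq⟩ : ∃ q, q = clamp b := ⟨_, rfl⟩
  have hp0 : 0 ≤ p := hp ▸ clamp_nonneg a
  have hpq : p ≤ q := hp ▸ hq ▸ clamp_mono hab
  have hq1 : q ≤ 1 := hq ▸ clamp_le_one b
  have hSab : ∀ s ∈ S, s = a ∨ s = b := fun s hs => by simpa using hsub hs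
  have h1 := hS.inter_Ioo (a := 0) (b := p) le_rfl (hpq.trans hq1) (fun s hs h => by
    rcases hSab s hs with rfl | rfl <;> unfold clamp at hp hq <;> grind) 0
  have h2 := hS.inter_Ioo (a := p) (b := q) hp0 hq1 (fun s hs h => by
    rcases hSab s hs with rfl | rfl <;> unfold clamp at hp hq <;> grind) 0
  have h3 := hS.inter_Ioo (a := q) (b := 1) (hp0.trans hpq) le_rfl (fun s hs h => by
    rcases hSab s hs with rfl | rfl <;> unfold clamp at hp hq <;> grind) 0
  have hval : ∀ {D : ℝ} (v : Valuation D), v.value (A.piece 0) =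
      v.value (A.piece 0 ∩ Set.Ioo 0 p) + v.value (A.piece 0 ∩ Set.Ioo p q) +
        v.value (A.piece 0 ∩ Set.Ioo q 1) := by
    intro D v
    have hmeas : MeasurableSet (A.piece 0) := by
      obtain ⟨-, F, hF, hord, -, h⟩ := A.isPiece 0
      rw [h]
      exact hF.measurableSet_sUnion fun I hI => (hord I hI).measurableSet
    have hsub : A.piece 0 ⊆ Set.Icc 0 1 := (A.isPiece 0).1
    rw [← v.value_union ?_ (hmeas.inter measurableSet_Ioo)
      (Set.inter_subset_left.trans hsub) (Set.inter_subset_left.trans hsub),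
      ← v.value_union ?_ (hmeas.inter measurableSet_Ioo)
      (Set.union_subset (Set.inter_subset_left.trans hsub) (Set.inter_subset_left.trans hsub))
      (Set.inter_subset_left.trans hsub)]
    · refine v.value_congr (E := {0, p, q, 1}) (by simp) fun x hx => ?_
      have := @hsub x
      simp only [Set.mem_insert_iff, Set.mem_singleton_iff, not_or, Set.mem_union,
        Set.mem_inter_iff, Set.mem_Ioo, Set.mem_Icc] at hx this ⊢
      grind
    · rw [Set.disjoint_left]
      simp only [Set.mem_union, Set.mem_inter_iff, Set.mem_Ioo]
      grind
    · rw [Set.disjoint_left]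
      simp only [Set.mem_inter_iff, Set.mem_Ioo]
      grind
  have hempty : ∀ {D : ℝ} (v : Valuation D), v.value ∅ = 0 := fun v => by
    simp [Valuation.value]
  have e1 : ∀ {D : ℝ} (v : Valuation D), v.value (Set.Ioo 0 p) = v.cdf p := fun v => by
    rw [v.value_Ioo le_rfl hp0 (hpq.trans hq1), v.cdf_zero, sub_zero]
  have e2 : ∀ {D : ℝ} (v : Valuation D), v.value (Set.Ioo p q) = v.cdf q - v.cdf p :=
    fun v => v.value_Ioo hp0 hpq hq1
  have e3 : ∀ {D : ℝ} (v : Valuation D), v.value (Set.Ioo q 1) = 1 - v.cdf q := fun v => by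
    rw [v.value_Ioo (hp0.trans hpq) hq1 le_rfl, v.cdf_one]
  rcases h1 with h1 | h1 <;> rcases h2 with h2 | h2 <;> rcases h3 with h3 | h3 <;>
    simp only [h1, h2, h3, hempty, e1, e2, e3] at hval
  · exact ⟨0, 0, le_rfl, le_rfl, zero_le_one, fun v => by rw [hval]; simp⟩
  · exact ⟨q, 1, hp0.trans hpq, hq1, le_rfl, fun v => by rw [hval]; simp⟩
  · exact ⟨p, q, hp0, hpq, hq1, fun v => by rw [hval]; simp⟩
  · exact ⟨p, 1, hp0, hpq.trans hq1, le_rfl, fun v => by rw [hval]; simp⟩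
  · exact ⟨0, p, le_rfl, hp0, hpq.trans hq1, fun v => by rw [hval]; simp⟩
  -- Piece 0 consists of the two outer intervals, so the middle one, its complement, is used.
  · refine ⟨p, q, hp0, hpq, hq1, fun v => ?_⟩
    rw [hval, ← abs_neg]
    congr 1
    ring
  · exact ⟨0, q, le_rfl, hp0.trans hpq, hq1, fun v => by rw [hval]; simp⟩
  · exact ⟨0, 1, le_rfl, zero_le_one, le_rfl, fun v => by rw [hval]; simp⟩

/-! ### Both cake-cutting problems contain the crossing problem for profiles -/

/-- From a solution of `R` with error `e` on the valuations that encode two profiles one can read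
off a point at which the sum of the profiles is `1` up to a constant multiple of `e`. -/
def EncodesCrossing (D : ℝ) (R : ℝ → Valuation D → Valuation D → Allocation 2 → Prop) : Prop :=
  ∃ c : ℝ, 0 < c ∧ ∃ (vA vB : {F // IsProfile F} → Valuation D) (pos : Allocation 2 → ℝ),
    ∀ F G e A, e < c → R e (vA F) (vB G) A → c * |F.1 (pos A) + G.1 (pos A) - 1| ≤ e

/-- The profile is shrunk into a central window of length `l`; the density is constant elsewhere. -/
theorem encodesCrossing_connectedEquitable {D : ℝ} (hD : 1 < D) :
    EncodesCrossing D (ConnectedEquitable D) := by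
  obtain ⟨l, hl⟩ : ∃ l, l = 1 - 1 / D := ⟨_, rfl⟩
  have hD0 : 0 < D := by linarith
  have hDinv : 1 / D < 1 := by rw [div_lt_one hD0]; exact hD
  have hDinv0 : 0 < 1 / D := by positivity
  have hl0 : 0 < l := by linarith
  have hl1 : l < 1 := by linarith
  -- The window is worth `l / 3`, so that the profile has slope at most 1 in it; the density `s`
  -- outside makes the total 1, and `1 / (1 - l) = D` keeps `s` below `D`.
  obtain ⟨s, hs⟩ : ∃ s, s = (1 - l / 3) / (1 - l) := ⟨_, rfl⟩
  have hs1 : 1 ≤ s := by rw [hs, le_div_iff₀ (by linarith)]; linarith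
  have hsl : s * (1 - l) = 1 - l / 3 := by rw [hs, div_mul_cancel₀]; linarith
  have hsD : s ≤ D := by
    rw [hs, div_le_iff₀ (by linarith), hl]
    have : D * (1 - (1 - 1 / D)) = 1 := by field_simp; ring
    rw [this]; linarith
  have hval : ∀ F : {F // IsProfile F}, ∃ v : Valuation D, ∀ p, v.cdf p =
      s * (p - l * clamp ((p - (1 - l) / 2) / l)) + l / 3 * F.1 ((p - (1 - l) / 2) / l) := by
    rintro ⟨F, hF⟩
    have hdiv : ∀ {a b : ℝ}, a ≤ b → (a - (1 - l) / 2) / l ≤ (b - (1 - l) / 2) / l := by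
      intro a b h; gcongr
    have hc : ∀ {a b : ℝ}, a ≤ b → l * (clamp ((b - (1 - l) / 2) / l) -
        clamp ((a - (1 - l) / 2) / l)) ≤ b - a := by
      intro a b h
      have h1 := mul_le_mul_of_nonneg_left (clamp_sub_le (hdiv h)) hl0.le
      have h2 : l * ((b - (1 - l) / 2) / l - (a - (1 - l) / 2) / l) = b - a := by
        field_simp; ring
      linarith
    have hsub : ∀ {a b : ℝ}, a ≤ b → 0 ≤ clamp ((b - (1 - l) / 2) / l) -
        clamp ((a - (1 - l) / 2) / l) := fun h => sub_nonneg.2 (clamp_mono (hdiv h))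
    refine exists_valuation _ ?_ ?_ ?_ ?_
    · have : (0 - (1 - l) / 2) / l ≤ 0 :=
        div_nonpos_of_nonpos_of_nonneg (by linarith) hl0.le
      simp only [clamp_of_nonpos this, hF.of_nonpos this]
      ring
    · have : 1 ≤ (1 - (1 - l) / 2) / l := by rw [le_div_iff₀ hl0]; linarith
      simp only [clamp_of_one_le this, hF.of_one_le this]
      linarith
    · intro a b h
      have h1 := mul_le_mul_of_nonneg_left (hc h) (show 0 ≤ s by linarith)
      have h2 := mul_le_mul_of_nonneg_left (hF.mono (hdiv h)) (show 0 ≤ l / 3 by linarith)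
      linarith
    · intro a b h
      have h1 := mul_le_mul_of_nonneg_right hs1 (mul_nonneg hl0.le (hsub h))
      have h2 := mul_le_mul_of_nonneg_left (hF.lip (hdiv h)) (show 0 ≤ l / 3 by linarith)
      have h3 := mul_le_mul_of_nonneg_right hsD (sub_nonneg.2 h)
      linarith
  choose v hv using hval
  have hpos : ∀ A : Allocation 2, ∃ p : ℝ, A.Connected → ∀ (e : ℝ) (v w : Valuation D),
      IsEquitable e ![v, w] A → |v.cdf p + w.cdf p - 1| ≤ e := by
    intro A
    by_cases hA : A.Connected
    · obtain ⟨p, hp⟩ := hA.exists_cut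
      exact ⟨p, fun _ _ => hp⟩
    · exact ⟨0, fun h => absurd h hA⟩
  choose pos hpos using hpos
  refine ⟨l / 3, by linarith, v, v, fun A => (pos A - (1 - l) / 2) / l, fun F G e A _ hR => ?_⟩
  refine le_trans ?_ (hpos A hR.1 e _ _ hR.2)
  have hu : l * ((pos A - (1 - l) / 2) / l) = pos A - (1 - l) / 2 := mul_div_cancel₀ _ hl0.ne'
  rw [hv, hv]
  dsimp only
  generalize (pos A - (1 - l) / 2) / l = u at hu ⊢
  obtain ⟨F, hF⟩ := F
  obtain ⟨G, hG⟩ := G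
  dsimp only
  -- In the window the first term vanishes; outside, both terms have the same sign, so the first
  -- cannot cancel the second.
  have key : s * (pos A - l * clamp u) + l / 3 * F u + (s * (pos A - l * clamp u) + l / 3 * G u) -
      1 = 2 * s * l * (u - clamp u) + l / 3 * (F u + G u - 1) := by
    linear_combination 2 * s * (-1) * hu + hsl
  rw [key]
  have hsl0 : 0 < 2 * s * l := by positivity
  rcases lt_or_ge u 0 with h | h
  · rw [hF.of_nonpos h.le, hG.of_nonpos h.le, clamp_of_nonpos h.le, abs_of_nonpos (by norm_num),
      abs_of_nonpos]
    · have := mul_neg_of_pos_of_neg hsl0 h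
      linarith
    · have := mul_neg_of_pos_of_neg hsl0 h
      linarith
  rcases lt_or_ge 1 u with h' | h'
  · have := mul_pos hsl0 (sub_pos.2 h')
    rw [hF.of_one_le h'.le, hG.of_one_le h'.le, clamp_of_one_le h'.le,
      abs_of_nonneg (by norm_num), abs_of_nonneg] <;> linarith
  · have : clamp u = u := by unfold clamp; grind
    rw [this, sub_self, mul_zero, zero_add, abs_mul, abs_of_pos (by linarith : 0 < l / 3)]

/-- A profile on `[1/8,3/8]`, followed by a plateau, a descent to `1/2` around the middle of the
cake, a second plateau, and a descent to `0` at its right end. -/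
noncomputable def bump (F : ℝ → ℝ) (p : ℝ) : ℝ :=
  F (4 * p - 1 / 2) - clamp (8 * p - 7 / 2) / 2 - clamp (16 * p - 15) / 2

theorem abs_bump_sub_le {F : ℝ → ℝ} (hF : IsProfile F) {a b : ℝ} (h : a ≤ b) :
    |bump F b - bump F a| ≤ 24 * (b - a) := by
  have h1 := hF.lip (show 4 * a - 1 / 2 ≤ 4 * b - 1 / 2 by linarith)
  have h2 := hF.mono (show 4 * a - 1 / 2 ≤ 4 * b - 1 / 2 by linarith)
  have h3 := clamp_sub_le (show 4 * a - 1 / 2 ≤ 4 * b - 1 / 2 by linarith)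
  have h4 := clamp_sub_le (show 8 * a - 7 / 2 ≤ 8 * b - 7 / 2 by linarith)
  have h5 := clamp_sub_le (show 16 * a - 15 ≤ 16 * b - 15 by linarith)
  have h6 := clamp_mono (show 8 * a - 7 / 2 ≤ 8 * b - 7 / 2 by linarith)
  have h7 := clamp_mono (show 16 * a - 15 ≤ 16 * b - 15 by linarith)
  unfold bump
  rw [abs_le]
  constructor <;> linarith

theorem bump_zero {F : ℝ → ℝ} (hF : IsProfile F) : bump F 0 = 0 := by
  unfold bump
  rw [hF.of_nonpos (by norm_num), clamp_of_nonpos (by norm_num), clamp_of_nonpos (by norm_num)]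
  norm_num

theorem bump_one {F : ℝ → ℝ} (hF : IsProfile F) : bump F 1 = 0 := by
  unfold bump
  rw [hF.of_one_le (by norm_num), clamp_of_one_le (by norm_num), clamp_of_one_le (by norm_num)]
  norm_num

theorem abs_bump_le {F : ℝ → ℝ} (hF : IsProfile F) (p : ℝ) : |bump F p| ≤ 1 := by
  have h1 := hF.nonneg (4 * p - 1 / 2)
  have h2 := hF.le_one (4 * p - 1 / 2)
  have h3 := clamp_nonneg (8 * p - 7 / 2)
  have h4 := clamp_le_one (8 * p - 7 / 2)
  have h5 := clamp_nonneg (16 * p - 15)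
  have h6 := clamp_le_one (16 * p - 15)
  unfold bump
  rw [abs_le]
  constructor <;> linarith

/-- As `q` is close to `p + 1/2`, a point `p` near the rising part puts `q` on the plateau of height
`1/2`, and the increments of the bumps add up to `1 - F - G`. All other `p` are excluded by the size
of the increments. -/
theorem abs_profile_add_sub_one_le {F G : ℝ → ℝ} (hF : IsProfile F) (hG : IsProfile G)
    {p q d : ℝ} (hp : 0 ≤ p) (hq : q ≤ 1) (hpq : |q - p - 1 / 2| ≤ 1 / 32) (hd : d < 1 / 2)
    (h : |(bump F q - bump F p) + (bump G q - bump G p)| ≤ d) :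
    |F (4 * p - 1 / 2) + G (4 * p - 1 / 2) - 1| ≤ d := by
  obtain ⟨h1, h2⟩ := abs_le.1 hpq
  obtain ⟨h3, h4⟩ := abs_le.1 h
  have hFq := hF.of_one_le (show 1 ≤ 4 * q - 1 / 2 by linarith)
  have hGq := hG.of_one_le (show 1 ≤ 4 * q - 1 / 2 by linarith)
  unfold bump at h3 h4
  rw [hFq, hGq] at h3 h4
  rcases lt_or_ge p (3 / 32) with hp1 | hp1
  · rw [hF.of_nonpos (show 4 * p - 1 / 2 ≤ 0 by linarith),
      hG.of_nonpos (show 4 * p - 1 / 2 ≤ 0 by linarith),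
      clamp_of_nonpos (show 8 * p - 7 / 2 ≤ 0 by linarith),
      clamp_of_nonpos (show 16 * p - 15 ≤ 0 by linarith),
      clamp_of_nonpos (show 16 * q - 15 ≤ 0 by linarith)] at h4
    linarith [clamp_le_one (8 * q - 7 / 2)]
  -- In the case just closed both bumps vanish at `p` and are at least `1/2` at `q`. For `p` beyond
  -- `13/32` each increment is at most `-1/4`, which contradicts `d < 1/2`.
  rcases lt_or_ge (13 / 32) p with hp2 | hp2
  · rw [hF.of_one_le (show 1 ≤ 4 * p - 1 / 2 by linarith),
      hG.of_one_le (show 1 ≤ 4 * p - 1 / 2 by linarith),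
      clamp_of_nonpos (show 16 * p - 15 ≤ 0 by linarith),
      clamp_of_one_le (show 1 ≤ 8 * q - 7 / 2 by linarith)] at h3
    unfold clamp at h3
    grind
  · rw [clamp_of_nonpos (show 8 * p - 7 / 2 ≤ 0 by linarith),
      clamp_of_nonpos (show 16 * p - 15 ≤ 0 by linarith),
      clamp_of_nonpos (show 16 * q - 15 ≤ 0 by linarith),
      clamp_of_one_le (show 1 ≤ 8 * q - 7 / 2 by linarith)] at h3 h4
    rw [abs_le]
    constructor <;> linarith

theorem encodesCrossing_perfectTwoCuts {D : ℝ} (hD : 1 < D) :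
    EncodesCrossing D (PerfectTwoCuts D) := by
  -- Bumps have slopes at most 24, so the densities stay between 0 and `D`. The bound `1/128` also
  -- makes the perturbation so small that `q - p` is within `1/32` of `1/2`.
  obtain ⟨c, hc0, hc1, hcD⟩ : ∃ c : ℝ, 0 < c ∧ c * 128 ≤ 1 ∧ c * 24 ≤ D - 1 := by
    refine ⟨min (1 / 128) ((D - 1) / 24), lt_min (by norm_num) (by linarith), ?_, ?_⟩
    · linarith [min_le_left (1 / 128 : ℝ) ((D - 1) / 24)]
    · linarith [min_le_right (1 / 128 : ℝ) ((D - 1) / 24)]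
  have hval : ∀ (σ : ℝ), |σ| = 1 → ∀ F : {F // IsProfile F}, ∃ v : Valuation D, ∀ p, v.cdf p =
      p + σ * c * bump F.1 p := by
    intro σ hσ F
    have hσ' : ∀ {a b : ℝ}, a ≤ b →
        |σ * c * bump F.1 b - σ * c * bump F.1 a| ≤ c * 24 * (b - a) := by
      intro a b h
      rw [← mul_sub, abs_mul, abs_mul, hσ, one_mul, abs_of_pos hc0, mul_assoc]
      exact mul_le_mul_of_nonneg_left (abs_bump_sub_le F.2 h) hc0.le
    refine exists_valuation _ ?_ ?_ ?_ ?_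
    · rw [bump_zero F.2, mul_zero, add_zero]
    · rw [bump_one F.2, mul_zero, add_zero]
    · intro a b h
      have h1 := (abs_le.1 (hσ' h)).1
      have h2 := mul_le_mul_of_nonneg_right (show c * 24 ≤ 1 by linarith) (sub_nonneg.2 h)
      linarith
    · intro a b h
      have h1 := (abs_le.1 (hσ' h)).2
      have h2 := mul_le_mul_of_nonneg_right hcD (sub_nonneg.2 h)
      linarith
  choose vA hA using hval 1 (by norm_num)
  choose vB hB using hval (-1) (by norm_num)
  have hpos : ∀ A : Allocation 2, ∃ p q : ℝ, A.CutsLE 2 → 0 ≤ p ∧ q ≤ 1 ∧ ∀ v : Valuation D,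
      |v.cdf q - v.cdf p - 1 / 2| = |v.value (A.piece 0) - 1 / 2| := by
    intro A
    by_cases hA : A.CutsLE 2
    · obtain ⟨p, q, hp, -, hq, h⟩ := hA.exists_interval
      exact ⟨p, q, fun _ => ⟨hp, hq, h⟩⟩
    · exact ⟨0, 0, fun h => absurd h hA⟩
  choose p q hpq using hpos
  -- The bound `e < c / 4` is what makes the discrepancy `2 * e / c` of the bumps smaller than
  -- `1/2`.
  refine ⟨c / 4, by linarith, vA, vB, fun A => 4 * p A - 1 / 2, fun F G e A he hR => ?_⟩
  obtain ⟨hp, hq, hval⟩ := hpq A hR.1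
  have h1 : |(vA F).value (A.piece 0) - 1 / 2| ≤ e := by simpa using hR.2 0 0
  have h2 : |(vB G).value (A.piece 0) - 1 / 2| ≤ e := by simpa using hR.2 1 0
  rw [← hval, hA, hA] at h1
  rw [← hval, hB, hB] at h2
  obtain ⟨h3, h4⟩ := abs_le.1 h1
  obtain ⟨h5, h6⟩ := abs_le.1 h2
  have hd : |(bump F.1 (q A) - bump F.1 (p A)) + (bump G.1 (q A) - bump G.1 (p A))| ≤
      2 * e / c := by
    rw [le_div_iff₀ hc0, ← abs_of_pos hc0, ← abs_mul, abs_le]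
    constructor <;> linarith
  have h7 : |q A - p A - 1 / 2| ≤ 1 / 32 := by
    have hb : ∀ x, c * |bump F.1 x| ≤ c := fun x =>
      mul_le_of_le_one_right hc0.le (abs_bump_le F.2 x)
    have hbq := hb (q A)
    have hbp := hb (p A)
    rw [← abs_of_pos hc0, ← abs_mul, abs_of_pos hc0, abs_le] at hbq hbp
    rw [abs_le]
    constructor <;> linarith
  have h8 := abs_profile_add_sub_one_le F.2 G.2 hp hq h7
    (by rw [div_lt_iff₀ hc0]; linarith) hd
  rw [le_div_iff₀ hc0] at h8
  linarith

/-! ### From protocols with rounds to alternating protocols on finite families of inputs -/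

/-- Bit strings of length at most `t` as elements of a finite type. -/
def encodeBits (t : ℕ) (s : List Bool) : Fin t → Option Bool := fun i => s[(i : ℕ)]?

theorem exists_decodeBits (t : ℕ) : ∃ dec : (Fin t → Option Bool) → List Bool,
    ∀ s : List Bool, s.length ≤ t → dec (encodeBits t s) = s := by
  have hinj : Set.InjOn (encodeBits t) {s | s.length ≤ t} := by
    intro s hs s' hs' h
    refine List.ext_getElem? fun i => ?_
    by_cases hi : i < t
    · exact congrFun h ⟨i, hi⟩
    · simp only [Set.mem_ofPred_eq] at hs hs'
      rw [List.getElem?_eq_none (by omega), List.getElem?_eq_none (by omega)]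
  exact ⟨Function.invFunOn (encodeBits t) {s | s.length ≤ t},
    fun s hs => hinj.leftInvOn_invFunOn hs⟩

/-- A simultaneous round is simulated by Alice's message followed by Bob's, which merely ignores
what Alice has just sent. -/
theorem altComputable_run {X Y : Type*} {Z U V : Type} {P : Protocol X Y Z} {t r : ℕ}
    (hP : P.IsTR t r) (a : U → X) (b : V → Y) :
    AltComputable (Fin t → Option Bool) (2 * r) fun u v => P.run (a u) (b v) := by
  obtain ⟨dec, hdec⟩ := exists_decodeBits t
  -- Induction on the number `j` of rounds left. The function is required to be correct only on
  -- inputs that lead to `τ`, so `τ` may be treated as known to both players.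
  have key : ∀ j i, i + j = r → ∀ τ : Transcript, ∃ f : U → V → Z,
      AltComputable (Fin t → Option Bool) (2 * j) f ∧
        ∀ u v, P.transcript (a u) (b v) i = τ → f u v = P.run (a u) (b v) := by
    intro j
    induction j with
    | zero =>
      intro i hi τ
      refine ⟨fun _ _ => P.output τ, ⟨_, fun _ _ => rfl⟩, fun u v h => ?_⟩
      rw [Protocol.run, hP.1, ← h, ← hi, Nat.add_zero]
    | succ j ih =>
      intro i hi τ
      choose F hF1 hF2 using ih (i + 1) (by omega)
      refine ⟨fun u v => F (τ ++ [(dec (encodeBits t (P.alice (a u) τ)),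
        dec (encodeBits t (P.bob (b v) τ)))]) u v, ?_, fun u v h => ?_⟩
      · exact ⟨fun u => encodeBits t (P.alice (a u) τ),
          fun m v u => F (τ ++ [(dec m, dec (encodeBits t (P.bob (b v) τ)))]) u v,
          fun m => ⟨fun v => encodeBits t (P.bob (b v) τ),
            fun m' u v => F (τ ++ [(dec m, dec m')]) u v, fun m' => hF1 _, fun _ _ => rfl⟩,
          fun _ _ => rfl⟩
      · refine hF2 _ u v ?_
        obtain ⟨h1, h2⟩ := hP.2 (a u) (b v) i (by omega)
        rw [h] at h1 h2
        rw [Protocol.transcript, h, hdec _ h1, hdec _ h2]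
  obtain ⟨f, hf1, hf2⟩ := key r 0 (Nat.zero_add r) []
  have : f = fun u v => P.run (a u) (b v) := funext fun u => funext fun v => hf2 u v rfl
  exact this ▸ hf1

open Classical in
/-- On every finite family of inputs, some alternating protocol with `2 * r` messages of `t` bits
solves `R` on a fraction of at least `s`. -/
def SolvableOnAverage {X Y : Type*} {Z : Type} (R : X → Y → Z → Prop) (s : ℝ) (t r : ℕ) : Prop :=
  ∀ (U V : Type) [Fintype U] [Fintype V] (a : U → X) (b : V → Y), ∃ f : U → V → Z,
    AltComputable (Fin t → Option Bool) (2 * r) f ∧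
      s * (Fintype.card V * Fintype.card U) ≤
        ∑ u, ∑ v, if R (a u) (b v) (f u v) then (1 : ℝ) else 0

theorem DeterministicallySolvable.solvableOnAverage {X Y : Type*} {Z : Type}
    {R : X → Y → Z → Prop} {t r : ℕ} (h : DeterministicallySolvable R t r) :
    SolvableOnAverage R 1 t r := by
  intro U V _ _ a b
  obtain ⟨P, hP, hR⟩ := h
  refine ⟨_, altComputable_run hP a b, ?_⟩
  simp [hR, mul_comm]

/-- Averaging, the easy direction of Yao's principle: some outcome of all coins does at least as
well on the finite family as the expectation. -/
theorem RandomizedSolvable.solvableOnAverage {X Y : Type*} {Z : Type} {R : X → Y → Z → Prop}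
    {δ : ℝ} {t r : ℕ} (h : RandomizedSolvable.{u} R δ t r) :
    SolvableOnAverage R (1 - δ) t r := by
  classical
  intro U V _ _ a b
  obtain ⟨Ω, ΩA, ΩB, _, _, _, μ, μA, μB, _, _, _, P, hP, hR⟩ := h
  choose E hE hμE hRE using fun u v => hR (a u) (b v)
  set ν := μ.prod (μA.prod μB)
  have hint : ∀ u v, Integrable ((E u v).indicator (1 : Ω × ΩA × ΩB → ℝ)) ν := fun u v =>
    (integrable_const (1 : ℝ)).indicator (hE u v)
  have hint' : Integrable (fun e => ∑ u, ∑ v, (E u v).indicator (1 : Ω × ΩA × ΩB → ℝ) e) ν :=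
    integrable_finsetSum _ fun u _ => integrable_finsetSum _ fun v _ => hint u v
  obtain ⟨e, he⟩ := exists_integral_le hint'
  refine ⟨fun u v => (P e.1).run (a u, e.2.1) (b v, e.2.2),
    altComputable_run (hP e.1) (fun u => (a u, e.2.1)) (fun v => (b v, e.2.2)), ?_⟩
  calc (1 - δ) * (Fintype.card V * Fintype.card U) = ∑ _u : U, ∑ _v : V, (1 - δ) := by
        simp; ring
    _ ≤ ∑ u, ∑ v, ν.real (E u v) := by
        gcongr with u _ v _
        exact (ENNReal.ofReal_le_iff_le_toReal (measure_ne_top _ _)).1 (hμE u v)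
    _ = ∫ e, ∑ u, ∑ v, (E u v).indicator (1 : Ω × ΩA × ΩB → ℝ) e ∂ν := by
        rw [integral_finsetSum _ fun u _ => integrable_finsetSum _ fun v _ => hint u v]
        refine Finset.sum_congr rfl fun u _ => ?_
        rw [integral_finsetSum _ fun v _ => hint u v]
        refine Finset.sum_congr rfl fun v _ => ?_
        rw [integral_indicator_one (hE u v)]
    _ ≤ ∑ u, ∑ v, (E u v).indicator (1 : Ω × ΩA × ΩB → ℝ) e := he
    _ ≤ _ := by
        gcongr with u _ v _
        by_cases hm : e ∈ E u v
        · simp [hm, hRE u v e hm]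
        · rw [Set.indicator_of_notMem hm]
          split_ifs <;> norm_num

/-! ### The lower bound -/

/-- Run on the encoded tree search inputs, the protocol yields allocations whose positions decode to
the path, so its success is bounded by that of `2 * r` messages at depth `2 * r + 1`. -/
theorem success_le_of_encodesCrossing {D : ℝ}
    {R : ℝ → Valuation D → Valuation D → Allocation 2 → Prop} {c : ℝ} (hc : 0 < c)
    {vA vB : {F // IsProfile F} → Valuation D} {pos : Allocation 2 → ℝ}
    (hR : ∀ F G e A, e < c → R e (vA F) (vB G) A → c * |F.1 (pos A) + G.1 (pos A) - 1| ≤ e)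
    {s e l : ℝ} {t r B : ℕ} (h : SolvableOnAverage (R e) s t r) (hB : 0 < B) (hl0 : 0 ≤ l)
    (hl1 : l ≤ 1) (he : e < c * width B ^ (2 * r + 1)) :
    s ≤ 1 / B + (2 * r : ℕ) * (2 * l + 3 ^ t * Real.exp (-(l ^ 2 * B))) := by
  classical
  obtain ⟨dec, hdec⟩ := exists_decoder hB (2 * r + 1)
  have hprof := isProfile_profile hB (2 * r + 1)
  obtain ⟨f, hf, hs⟩ := h (Inst B (2 * r + 1)).1 (Inst B (2 * r + 1)).2
    (fun x => vA ⟨_, hprof.1 x⟩) (fun y => vB ⟨_, hprof.2 y⟩)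
  have hw := width_pos hB
  have hw1 : width B ≤ 1 := by
    have h1 := start_add_width_le ⟨0, hB⟩
    have h2 := quarter_le_start B (⟨0, hB⟩ : Fin B)
    linarith
  have hec : e < c := he.trans_le (mul_le_of_le_one_right hc.le (pow_le_one₀ hw.le hw1))
  have hle := sum_success_le (M := Fin t → Option Bool) hB hl0 hl1 (2 * r)
    (fun x y => dec (pos (f x y))) (hf.comp (fun A => dec (pos A)) id id)
  have hcard : (0 : ℝ) < Fintype.card (Inst B (2 * r + 1)).2 *
      Fintype.card (Inst B (2 * r + 1)).1 := by
    have h1 := Fintype.card_pos_iff.2 (nonempty_inst hB (2 * r + 1)).1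
    have h2 := Fintype.card_pos_iff.2 (nonempty_inst hB (2 * r + 1)).2
    positivity
  have hM : ((Fintype.card (Fin t → Option Bool) : ℕ) : ℝ) = 3 ^ t := by simp
  rw [hM] at hle
  refine le_of_mul_le_mul_right (hs.trans (le_trans ?_ hle)) hcard
  gcongr with x _ y _
  split_ifs with h1 h2 h2
  · exact le_rfl
  · refine absurd (hdec x y _ ?_) h2
    have := (hR _ _ _ _ hec h1).trans_lt he
    exact lt_of_mul_lt_mul_left this hc.le
  · norm_num
  · exact le_rfl

theorem eventually_exists_parameters (K : ℝ) (k : ℕ) {s c : ℝ} (hs : 0 < s) (hc : 0 < c) :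
    ∀ᶠ L : ℝ in atTop, ∀ t r : ℕ, (t : ℝ) ≤ K * L ^ k →
      r < 1 / (4 * (k + 8)) * (L / Real.log L) → ∃ (B : ℕ) (l : ℝ), 0 < B ∧ 0 ≤ l ∧ l ≤ 1 ∧
        Real.exp (-L) < c * width B ^ (2 * r + 1) ∧
        1 / B + (2 * r : ℕ) * (2 * l + 3 ^ t * Real.exp (-(l ^ 2 * B))) < s := by
  have hk : (0 : ℝ) < 4 * (k + 8) := by positivity
  have hlog := Real.isLittleO_log_id_atTop.bound (show 0 < 1 / (4 * ((k : ℝ) + 8)) by positivity)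
  filter_upwards [eventually_ge_atTop (2 : ℝ), eventually_ge_atTop (Real.exp 1),
    eventually_ge_atTop (2 * |K| + 1), eventually_gt_atTop (9 / s),
    eventually_gt_atTop (-(4 * Real.log c)), hlog] with L hL2 hLe hLK hLs hLc hlog t r ht hr
  have hL0 : 0 < L := by linarith
  have hlog1 : 1 ≤ Real.log L := by rwa [Real.le_log_iff_exp_le hL0]
  have hlog2 : 4 * (k + 8) * Real.log L ≤ L := by
    rw [Real.norm_of_nonneg (by linarith), id, Real.norm_of_nonneg hL0.le, one_div_mul_eq_div,
      le_div_iff₀ hk] at hlog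
    linarith
  have hr1 : 4 * (k + 8) * (r * Real.log L) ≤ L := by
    have h1 := mul_lt_mul_of_pos_right hr (show 0 < Real.log L by linarith)
    have h2 : 1 / (4 * (k + 8)) * (L / Real.log L) * Real.log L = L / (4 * (k + 8)) := by
      field_simp
    rw [h2, lt_div_iff₀ hk] at h1
    linarith
  have hrL : (r : ℝ) ≤ L := by
    have h1 : (r : ℝ) ≤ r * Real.log L := le_mul_of_one_le_right (Nat.cast_nonneg r) hlog1
    have h2 : 1 * ((r : ℝ) * Real.log L) ≤ 4 * (k + 8) * (r * Real.log L) := by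
      gcongr
      have : (0 : ℝ) ≤ k := Nat.cast_nonneg k
      linarith
    linarith
  -- With `l = 1 / L ^ 2` this gives `l ^ 2 * B ≥ L ^ (k + 2)`, which beats the `3 ^ t` messages, as
  -- `t` is at most of order `L ^ k`; and `r ≤ L` makes the total loss at most `9 / L`.
  set B := ⌈L ^ (k + 6)⌉₊ with hBdef
  have hpow1 : ∀ n : ℕ, 1 ≤ L ^ n := fun n => one_le_pow₀ (by linarith)
  have hBge : L ^ (k + 6) ≤ B := Nat.le_ceil _
  have hB0 : 0 < B := Nat.ceil_pos.2 (by positivity)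
  have hB0' : (0 : ℝ) < B := Nat.cast_pos.2 hB0
  have hBle : 2 * (B : ℝ) ≤ L ^ (k + 8) := by
    have h1 := (Nat.ceil_lt_add_one (show 0 ≤ L ^ (k + 6) by positivity)).le
    have h2 := hpow1 (k + 6)
    have h3 : 4 * L ^ (k + 6) ≤ L ^ 2 * L ^ (k + 6) := by gcongr; nlinarith
    have h4 : L ^ (k + 8) = L ^ 2 * L ^ (k + 6) := by ring
    linarith
  refine ⟨B, 1 / L ^ 2, hB0, by positivity, ?_, ?_, ?_⟩
  · rw [div_le_one (by positivity)]
    exact hpow1 2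
  · have hwidth : Real.exp (-((k + 8) * Real.log L)) ≤ width B := by
      have h1 : Real.exp ((k + 8) * Real.log L) = L ^ (k + 8) := by
        rw [show ((k : ℝ) + 8) = ((k + 8 : ℕ) : ℝ) by push_cast; ring, Real.exp_nat_mul,
          Real.exp_log hL0]
      rw [Real.exp_neg, h1, width, ← one_div]
      gcongr
    -- Of the budget `L`, the `2 * r` levels use at most one half, the extra level at most a
    -- quarter, and `-log c` less than the last quarter.
    calc Real.exp (-L)
        < Real.exp (Real.log c + (2 * r + 1 : ℕ) * -((k + 8) * Real.log L)) := by
          rw [Real.exp_lt_exp]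
          push_cast
          linarith
      _ = c * Real.exp (-((k + 8) * Real.log L)) ^ (2 * r + 1) := by
          rw [Real.exp_add, Real.exp_log hc, Real.exp_nat_mul]
      _ ≤ _ := by gcongr
  · have h1 : (1 : ℝ) / B ≤ 1 / L := by
      gcongr
      calc L = L ^ 1 := (pow_one L).symm
        _ ≤ L ^ (k + 6) := pow_le_pow_right₀ (by linarith) (by omega)
        _ ≤ B := hBge
    have h2 : (3 : ℝ) ^ t * Real.exp (-((1 / L ^ 2) ^ 2 * B)) ≤ Real.exp (-L) := by
      have h3 : (3 : ℝ) ^ t ≤ Real.exp (t * 2) := by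
        rw [Real.exp_nat_mul]
        gcongr
        linarith [Real.add_one_le_exp 2]
      have h4 : L ^ (k + 2) ≤ (1 / L ^ 2) ^ 2 * B := by
        calc L ^ (k + 2) = (1 / L ^ 2) ^ 2 * L ^ (k + 6) := by field_simp; ring
          _ ≤ _ := by gcongr
      have h5 : (t : ℝ) ≤ |K| * L ^ k := ht.trans (by gcongr; exact le_abs_self K)
      have h6 : 2 * |K| * L ^ k + L * L ^ k ≤ L ^ (k + 2) := by
        calc 2 * |K| * L ^ k + L * L ^ k = (2 * |K| + L) * L ^ k := by ring
          _ ≤ L ^ 2 * L ^ k := by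
            gcongr
            have := abs_nonneg K
            nlinarith
          _ = _ := by ring
      have h7 : L ≤ L * L ^ k := le_mul_of_one_le_right hL0.le (hpow1 k)
      calc (3 : ℝ) ^ t * Real.exp (-((1 / L ^ 2) ^ 2 * B))
          ≤ Real.exp (t * 2) * Real.exp (-((1 / L ^ 2) ^ 2 * B)) := by gcongr
        _ = Real.exp (t * 2 + -((1 / L ^ 2) ^ 2 * B)) := (Real.exp_add _ _).symm
        _ ≤ _ := by
          rw [Real.exp_le_exp]
          linarith
    have h3 : Real.exp (-L) ≤ 2 / L ^ 2 := by
      have := Real.quadratic_le_exp_of_nonneg hL0.le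
      rw [Real.exp_neg, ← one_div, div_le_div_iff₀ (Real.exp_pos L) (by positivity)]
      linarith
    calc 1 / (B : ℝ) + (2 * r : ℕ) * (2 * (1 / L ^ 2) +
          3 ^ t * Real.exp (-((1 / L ^ 2) ^ 2 * B)))
        ≤ 1 / L + 2 * L * (2 * (1 / L ^ 2) + 2 / L ^ 2) := by
          push_cast
          gcongr
          exact h2.trans h3
      _ = 9 / L := by field_simp; norm_num
      _ < s := by
          rw [div_lt_iff₀ hs] at hLs
          rw [div_lt_iff₀ hL0]
          linarith

theorem EncodesCrossing.eventually_le {D : ℝ}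
    {R : ℝ → Valuation D → Valuation D → Allocation 2 → Prop} (hR : EncodesCrossing D R)
    (K : ℝ) (k : ℕ) {s : ℝ} (hs : 0 < s) :
    ∀ᶠ e : ℝ in 𝓝[>] 0, ∀ t r : ℕ, (t : ℝ) ≤ K * Real.log e⁻¹ ^ k →
      SolvableOnAverage (R e) s t r →
        1 / (4 * ((k : ℝ) + 8)) * (Real.log e⁻¹ / Real.log (Real.log e⁻¹)) ≤ r := by
  obtain ⟨c, hc, vA, vB, pos, hpos⟩ := hR
  have hlim : Tendsto (fun e : ℝ => Real.log e⁻¹) (𝓝[>] 0) atTop :=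
    Real.tendsto_log_atTop.comp tendsto_inv_nhdsGT_zero
  filter_upwards [hlim.eventually (eventually_exists_parameters K k hs hc), self_mem_nhdsWithin]
    with e he he0 t r ht h
  by_contra! hr
  obtain ⟨B, l, hB, hl0, hl1, hw, hlt⟩ := he t r ht hr
  rw [Real.log_inv, neg_neg, Real.exp_log he0] at hw
  exact (success_le_of_encodesCrossing hc hpos h hB hl0 hl1 hw).not_gt hlt

end CakeCutting

theorem mainTheorem2 (D : ℝ) (hD : 1 < D) (K : ℝ) (k : ℕ) (δ : ℝ) (hδ : δ < 1) :
    ∃ c : ℝ, 0 < c ∧ ∀ᶠ ε : ℝ in 𝓝[>] 0, ∀ t r : ℕ, (t : ℝ) ≤ K * Real.log ε⁻¹ ^ k →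
      (CakeCutting.DeterministicallySolvable (CakeCutting.PerfectTwoCuts D ε) t r ∨
        CakeCutting.RandomizedSolvable.{u} (CakeCutting.PerfectTwoCuts D ε) δ t r ∨
        CakeCutting.DeterministicallySolvable (CakeCutting.ConnectedEquitable D ε) t r ∨
        CakeCutting.RandomizedSolvable.{u} (CakeCutting.ConnectedEquitable D ε) δ t r) →
      c * (Real.log ε⁻¹ / Real.log (Real.log ε⁻¹)) ≤ (r : ℝ) := by
  have hP := CakeCutting.encodesCrossing_perfectTwoCuts hD
  have hE := CakeCutting.encodesCrossing_connectedEquitable hD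
  refine ⟨1 / (4 * ((k : ℝ) + 8)), by positivity, ?_⟩
  filter_upwards [hP.eventually_le K k one_pos, hP.eventually_le K k (sub_pos.2 hδ),
    hE.eventually_le K k one_pos, hE.eventually_le K k (sub_pos.2 hδ)]
    with ε h1 h2 h3 h4 t r ht h
  rcases h with h | h | h | h
  · exact h1 t r ht h.solvableOnAverage
  · exact h2 t r ht h.solvableOnAverage
  · exact h3 t r ht h.solvableOnAverage
  · exact h4 t r ht h.solvableOnAverage
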